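/- Let $N\ge 0$, let $V=\mathbb{C}^k$ be equipped with an arbitrary norm $\|\cdot\|$, use the same symbol for the induced operator norm on $\mathbb{C}^{k\times k}$, and let $A_0,\dots,A_N\in\mathbb{C}^{k\times k}$. Let \[ M=\begin{bmatrix}A_0&A_1&\cdots&A_{N-1}&A_N\\ I&0&\cdots&0&0\\ 0&I&\cdots&0&0\\ \vdots&&\ddots&&\vdots\\ 0&0&\cdots&I&0\end{bmatrix} \] be the block companion matrix, and let $E_1,\dots,E_{N+1}$ be the block columns (of width $k$) of the identity matrix of size $(N+1)k$. For $0\le j\le N$ put $T_j(z)^{-1}:=E_1^T(zI-M)^{-1}E_{j+1}$ (a rational matrix function, even if it is not invertible). For $\varepsilon>0$ let \[ \Lambda_\varepsilon(T_j)=\{z\in\mathbb{C}:\ \|T_j(z)^{-1}\|>\varepsilon^{-1}\}, \] where $\|T_j(z)^{-1}\|=\infty$ at the poles of $T_j^{-1}$ and removable singularities are removed. Let $L_\varepsilon^{(j)}\in[0,\infty]$ be the arc length (one-dimensional Hausdorff measure) of the boundary of $\Lambda_\varepsilon(T_j)$, and let $\rho_\varepsilon(T_j)=\sup\{|z|: z\in\Lambda_\varepsilon(T_j)\}$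 be the pseudospectral radius, with $\sup\emptyset=0$. Suppose that $(y_n)_{n\ge -N}$ in $\mathbb{C}^k$ satisfies $y_{n+1}=\sum_{j=0}^N A_j\,y_{n-j}$ for all $n\ge 0$, with $y_0,y_{-1},\dots,y_{-N}$ given. Then for every $\varepsilon>0$ and every $n\ge 0$ \[ \|y_n\|\ \le\ \sum_{j=0}^N \frac{L_\varepsilon^{(j)}\,\rho_\varepsilon(T_j)^n}{2\pi\varepsilon}\,\|y_{-j}\| , \] and $\rho_\varepsilon(T_j)<\infty$ for every $j$. If the norm on $\mathbb{C}^k$ is induced by an inner product (for example the Euclidean norm, so that the matrix norm is the spectral norm), then also $L_\varepsilon^{(j)}<\infty$ for every $j$, and so the right-hand side is finite for every $\varepsilon>0$ and every $n\ge0$. -/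

import Mathlib

open Filter Topology MeasureTheory
open scoped ENNReal

noncomputable section

namespace DiffEq

/-- The block companion matrix of `y_{n+1} = ∑_{j=0}^N A_j y_{n-j}`, as an operator on `V^{N+1}`.
Its first block row is `A_0, …, A_N`, the blocks directly below the diagonal are identities, and
all other blocks vanish, so it maps `[y_n, …, y_{n-N}]` to `[y_{n+1}, …, y_{n-N+1}]`.
(The norm that `Fin (N + 1) → V` carries plays no role.) -/
def companion {V : Type*} [NormedAddCommGroup V] [NormedSpace ℂ V] {N : ℕ}
    (A : Fin (N + 1) → V →L[ℂ] V) : (Fin (N + 1) → V) →L[ℂ] (Fin (N + 1) → V) :=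
  ContinuousLinearMap.pi fun i =>
    Fin.cases (∑ j, (A j).comp (ContinuousLinearMap.proj j))
      (fun i' : Fin N => ContinuousLinearMap.proj i'.castSucc) i

/-- The generalized resolvent `T_j(z)⁻¹ = E_1ᵀ (z I - M)⁻¹ E_{j+1}`, where `M` is the block
companion matrix. Here `E_1ᵀ` is the projection of `V^{N+1}` to its first block, which has the
index `0`, and `E_{j+1}` is the inclusion of the block with the index `j`. The formula is
meaningful for `z` outside the spectrum of `M`; its value on that finite set is never used. -/
def genResolvent {V : Type*} [NormedAddCommGroup V] [NormedSpace ℂ V] {N : ℕ}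
    (A : Fin (N + 1) → V →L[ℂ] V) (j : Fin (N + 1)) (z : ℂ) : V →L[ℂ] V :=
  (ContinuousLinearMap.proj 0).comp
    ((resolvent (companion A) z).comp (ContinuousLinearMap.single ℂ (fun _ : Fin (N + 1) => V) j))

/-- The operator norm of `T(z)⁻¹`, as an element of `[0, ∞]`. Here `R = T⁻¹` is an operator-valued
function that is analytic up to isolated singularities, and its norm is read as the limit of
`‖R w‖` for `w → z`, `w ≠ z`. So it is `‖R z‖` wherever `R` is continuous, it is `∞` at the poles
of `R`, and removable singularities are removed. -/
def resolventNorm {V : Type*} [NormedAddCommGroup V] [NormedSpace ℂ V]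
    (R : ℂ → V →L[ℂ] V) (z : ℂ) : ℝ≥0∞ :=
  limsup (fun w => ‖R w‖ₑ) (𝓝[≠] z)

theorem resolventNorm_eq {V : Type*} [NormedAddCommGroup V] [NormedSpace ℂ V]
    (R : ℂ → V →L[ℂ] V) (z : ℂ) (h : ContinuousAt R z) : resolventNorm R z = ‖R z‖ₑ :=
  Tendsto.limsup_eq (h.enorm.tendsto.mono_left nhdsWithin_le_nhds)

/-- The `ε`-pseudospectrum `Λ_ε(T) = {z | ‖T(z)⁻¹‖ > ε⁻¹}`, in terms of `R = T⁻¹`. -/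
def pseudospectrum {V : Type*} [NormedAddCommGroup V] [NormedSpace ℂ V]
    (R : ℂ → V →L[ℂ] V) (ε : ℝ) : Set ℂ :=
  {z | ENNReal.ofReal ε⁻¹ < resolventNorm R z}

/-- The arc length (one-dimensional Hausdorff measure) of the boundary of `Λ_ε(T)`. -/
def boundaryLength {V : Type*} [NormedAddCommGroup V] [NormedSpace ℂ V]
    (R : ℂ → V →L[ℂ] V) (ε : ℝ) : ℝ≥0∞ :=
  Measure.hausdorffMeasure 1 (frontier (pseudospectrum R ε))

/-- The pseudospectral radius `ρ_ε(T)`, the supremum of `|z|` over `z ∈ Λ_ε(T)` (zero if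
`Λ_ε(T)` is empty). -/
def pseudospectralRadius {V : Type*} [NormedAddCommGroup V] [NormedSpace ℂ V]
    (R : ℂ → V →L[ℂ] V) (ε : ℝ) : ℝ≥0∞ :=
  ⨆ z ∈ pseudospectrum R ε, ‖z‖ₑ

/-- The bound `∑_{j=0}^N L_ε^{(j)} ρ_ε(T_j)^n / (2 π ε) ‖y_{-j}‖`, as an element of `[0, ∞]`. -/
def growthBound {V : Type*} [NormedAddCommGroup V] [NormedSpace ℂ V] {N : ℕ}
    (A : Fin (N + 1) → V →L[ℂ] V) (y : ℤ → V) (ε : ℝ) (n : ℕ) : ℝ≥0∞ :=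
  ∑ j : Fin (N + 1),
    boundaryLength (genResolvent A j) ε * pseudospectralRadius (genResolvent A j) ε ^ n /
      ENNReal.ofReal (2 * Real.pi * ε) * ‖y (-((j : ℕ) : ℤ))‖ₑ

end DiffEq

end

/-! With `M` the companion matrix, `y n` is the first block of `M ^ n` applied to the initial data,
so it suffices to bound each block `Φ (M ^ n)`, where `Φ` extracts the block with indices `0` and
`j`. This block is a Laurent coefficient at infinity: `(2πi)⁻¹ ∮ zⁿ Φ ((z - M)⁻¹) dz` over large
circles. Moving the contour to the boundary of `U = Λ_ε(T_j)`, where `‖T_j⁻¹‖ ≤ ε⁻¹` and `|z| ≤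
ρ_ε`, gives the bound.

For an arbitrary norm that boundary need not be a rectifiable contour, so the deformation is done
with cutoffs. For `C¹` compactly supported `w` equal to `1` near the singularities of `f`, the
integral `∫ (∂̄w) f` over the plane does not depend on `w` (`integral_dbar_smul_eq`). A radial
cutoff turns it into integrals over large circles; the mollified indicator of `U` concentrates it
near `∂U` with `∫ |∇w| ≤ H¹(∂U)` (`exists_cutoff`). The constant `1` comes from a sweeping estimate:
the points that a translation by `t` carries across `∂U` have area at most `t · H¹(∂U)`
(`volume_stepsInto_le`). `enorm_le_of_frontier` combines these facts, and `enorm_apply_pow_le`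
applies them to `zⁿ T_j⁻¹`.

The radius is finite because the resolvent vanishes at infinity. For an inner product norm, let `q ≠
0` annihilate `M`. Then `G = q T_j⁻¹` is a polynomial in `z`, and off the zeros of `q` a boundary
point satisfies `det (|q|² - ε² G* G) = 0`. This is a nonzero polynomial in the real and the
imaginary part of `z`, and bounded pieces of its zero set have finite length
(`hausdorffMeasure_zeros_lt_top`). -/

namespace DiffEq

/-! ### Area swept by short steps into a set of finite length. -/

/-- The points from which a step of length at most `t` in the direction `e` leads into `B`. -/
def stepsInto (B : Set ℂ) (e : ℂ) (t : ℝ) : Set ℂ :=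
  {z | ∃ u ∈ Set.Icc 0 t, z + (u : ℂ) * e ∈ B}

/-- Horizontal shifts by at most `t` widen the projection to the real axis by `t` and leave the one
to the imaginary axis unchanged, so everything fits into the product of these projections. -/
theorem volume_stepsInto_one_le_ediam (C : Set ℂ) {t : ℝ} :
    volume (stepsInto C 1 t) ≤ (Metric.ediam C + ENNReal.ofReal t) * Metric.ediam C := by
  set A : Set ℝ := {x | ∃ u ∈ Set.Icc 0 t, x + u ∈ Complex.re '' C} with hA
  have hsub : stepsInto C 1 t ⊆ Complex.measurableEquivRealProd ⁻¹' (A ×ˢ (Complex.im '' C)) := by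
    rintro z ⟨u, hu, hz⟩
    refine ⟨⟨u, hu, _, hz, ?_⟩, _, hz, ?_⟩ <;> simp [Complex.measurableEquivRealProd]
  have hre : ∀ x ∈ C, ∀ y ∈ C, edist x.re y.re ≤ Metric.ediam C := fun x hx y hy => by
    refine le_trans ?_ (Metric.edist_le_ediam_of_mem hx hy)
    rw [edist_dist, edist_dist, Real.dist_eq, Complex.dist_eq, ← Complex.sub_re]
    exact ENNReal.ofReal_le_ofReal (Complex.abs_re_le_norm _)
  have him : ∀ x ∈ C, ∀ y ∈ C, edist x.im y.im ≤ Metric.ediam C := fun x hx y hy => by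
    refine le_trans ?_ (Metric.edist_le_ediam_of_mem hx hy)
    rw [edist_dist, edist_dist, Real.dist_eq, Complex.dist_eq, ← Complex.sub_im]
    exact ENNReal.ofReal_le_ofReal (Complex.abs_im_le_norm _)
  have hAd : Metric.ediam A ≤ Metric.ediam C + ENNReal.ofReal t := by
    refine Metric.ediam_le ?_
    rintro x ⟨u, hu, p, hp, hpx⟩ y ⟨v, hv, q, hq, hqy⟩
    have h1 : edist x y ≤ edist p.re q.re + edist u v := by
      have hx : x = p.re - u := by linarith
      have hy : y = q.re - v := by linarith
      simp only [edist_dist, Real.dist_eq]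
      rw [← ENNReal.ofReal_add (abs_nonneg _) (abs_nonneg _)]
      refine ENNReal.ofReal_le_ofReal ?_
      rw [hx, hy, show p.re - u - (q.re - v) = (p.re - q.re) + (v - u) by ring, abs_sub_comm u v]
      exact abs_add_le _ _
    refine h1.trans (add_le_add (hre p hp q hq) ?_)
    rw [edist_dist, Real.dist_eq]
    refine ENNReal.ofReal_le_ofReal ?_
    rw [abs_le]; constructor <;> linarith [hu.1, hu.2, hv.1, hv.2]
  calc volume (stepsInto C 1 t)
      ≤ volume (Complex.measurableEquivRealProd ⁻¹' (A ×ˢ (Complex.im '' C))) := measure_mono hsub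
    _ = volume (A ×ˢ (Complex.im '' C)) :=
        Complex.volume_preserving_equiv_real_prod.measure_preimage_equiv _
    _ = volume A * volume (Complex.im '' C) := Measure.prod_prod _ _
    _ ≤ _ := by
        refine mul_le_mul' ((Real.volume_le_diam _).trans hAd) ((Real.volume_le_diam _).trans ?_)
        refine Metric.ediam_le ?_
        rintro _ ⟨p, hp, rfl⟩ _ ⟨q, hq, rfl⟩
        exact him p hp q hq

/-- Summing the rectangle bound over a cover by pieces of diameter at most `r` gives `(r + t) ∑
diam`. The factor becomes `t` as `r → 0`. -/
theorem volume_stepsInto_one_le (B : Set ℂ) {t : ℝ} (ht : 0 < t) :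
    volume (stepsInto B 1 t) ≤ ENNReal.ofReal t * Measure.hausdorffMeasure 1 B := by
  rcases eq_or_ne (Measure.hausdorffMeasure 1 B : ℝ≥0∞) ∞ with htop | htop
  · rw [htop, ENNReal.mul_top (by simpa using ht)]; exact le_top
  have key : ∀ r : ℝ≥0∞, r ∈ Set.Ioo 0 ∞ →
      volume (stepsInto B 1 t) ≤ (r + ENNReal.ofReal t) * Measure.hausdorffMeasure 1 B := by
    intro r ⟨hr, hrt⟩
    have h1 : (⨅ (c : ℕ → Set ℂ) (_ : B ⊆ ⋃ n, c n) (_ : ∀ n, Metric.ediam (c n) ≤ r),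
        ∑' n, ⨆ (_ : (c n).Nonempty), Metric.ediam (c n) ^ (1 : ℝ)) ≤
        Measure.hausdorffMeasure 1 B := by
      rw [Measure.hausdorffMeasure_apply]
      exact le_iSup₂ (f := fun (r : ℝ≥0∞) (_ : 0 < r) =>
        ⨅ (c : ℕ → Set ℂ) (_ : B ⊆ ⋃ n, c n) (_ : ∀ n, Metric.ediam (c n) ≤ r),
        ∑' n, ⨆ (_ : (c n).Nonempty), Metric.ediam (c n) ^ (1 : ℝ)) r hr
    refine le_trans ?_ (mul_le_mul_right h1 _)
    have h0 : r + ENNReal.ofReal t ≠ 0 := by simp [hr.ne']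
    have h2 : r + ENNReal.ofReal t ≠ ∞ := by finiteness
    simp only [ENNReal.mul_iInf_of_ne h0 h2]
    refine le_iInf fun c => le_iInf fun hc => le_iInf fun hd => ?_
    rw [← ENNReal.tsum_mul_left]
    have hs : stepsInto B 1 t ⊆ ⋃ n, stepsInto (c n) 1 t := by
      rintro z ⟨u, hu, hz⟩
      obtain ⟨n, hn⟩ := Set.mem_iUnion.1 (hc hz)
      exact Set.mem_iUnion.2 ⟨n, u, hu, hn⟩
    refine ((measure_mono hs).trans (measure_iUnion_le _)).trans (ENNReal.tsum_le_tsum fun n => ?_)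
    rcases (c n).eq_empty_or_nonempty with he | hne
    · have : stepsInto (c n) 1 t = ∅ := by ext z; simp [stepsInto, he]
      simp [this]
    · refine (volume_stepsInto_one_le_ediam _).trans ?_
      simp only [hne, ENNReal.rpow_one, ciSup_pos]
      gcongr
      exact hd n
  refine ge_of_tendsto (x := 𝓝[>] (0 : ℝ≥0∞))
    (f := fun r => (r + ENNReal.ofReal t) * Measure.hausdorffMeasure 1 B) ?_ ?_
  · have : Tendsto (fun r : ℝ≥0∞ => (r + ENNReal.ofReal t) * Measure.hausdorffMeasure 1 B)
        (𝓝 0) (𝓝 ((0 + ENNReal.ofReal t) * Measure.hausdorffMeasure 1 B)) :=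
      ENNReal.Tendsto.mul_const (tendsto_id.add tendsto_const_nhds) (Or.inr htop)
    rw [zero_add] at this
    exact this.mono_left nhdsWithin_le_nhds
  · filter_upwards [Ioo_mem_nhdsGT ENNReal.zero_lt_top] with r hr using key r hr

theorem volume_stepsInto_le (B : Set ℂ) {e : ℂ} (he : ‖e‖ = 1) {t : ℝ} (ht : 0 < t) :
    volume (stepsInto B e t) ≤ ENNReal.ofReal t * Measure.hausdorffMeasure 1 B := by
  let a : Circle := ⟨e, by simpa [Submonoid.unitSphere] using he⟩
  let ρ : ℂ ≃ₗᵢ[ℝ] ℂ := rotation a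
  have hρ : ∀ z, ρ z = e * z := fun z => rotation_apply a z
  have h1 : stepsInto (ρ ⁻¹' B) 1 t = ρ ⁻¹' stepsInto B e t := by
    ext z
    simp only [stepsInto, Set.mem_ofPred_eq, Set.mem_preimage, hρ, mul_one, mul_add]
    simp only [mul_comm e]
  have h2 : volume (ρ ⁻¹' stepsInto B e t) = volume (stepsInto B e t) :=
    ρ.measurePreserving.measure_preimage_equiv (f := ρ.toHomeomorph.toMeasurableEquiv) _
  have h3 : (Measure.hausdorffMeasure 1 (ρ ⁻¹' B) : ℝ≥0∞) = Measure.hausdorffMeasure 1 B :=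
    ρ.toIsometryEquiv.hausdorffMeasure_preimage 1 B
  rw [← h2, ← h1, ← h3]
  exact volume_stepsInto_one_le _ ht

/-- By the layer cake formula only superlevel sets matter: a step of length at most `t` changes `φ`
by at most `L * t`, so the set `φ > s` is carried into `φ + L * t > s`, and the sweeping estimate
applies at every level `s`. -/
theorem lintegral_stepsInto_le {K : Set ℂ} {φ : ℂ → ℝ} (h0 : ∀ z, 0 ≤ φ z)
    {L : NNReal} (hφ : LipschitzWith L φ) {e : ℂ} (he : ‖e‖ = 1) {t : ℝ} (ht : 0 < t) :
    ∫⁻ z in stepsInto K e t, ENNReal.ofReal (φ z) ≤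
      ENNReal.ofReal t * ∫⁻ z in K, ENNReal.ofReal (φ z + L * t) ∂Measure.hausdorffMeasure 1 := by
  have hc := hφ.continuous
  rw [lintegral_eq_lintegral_meas_lt _ (.of_forall h0) hc.aemeasurable,
    lintegral_eq_lintegral_meas_lt _ (.of_forall fun z => by have := h0 z; positivity)
      (by fun_prop),
    ← lintegral_const_mul' _ _ ENNReal.ofReal_ne_top]
  refine lintegral_mono fun s => ?_
  rw [Measure.restrict_apply (measurableSet_lt measurable_const hc.measurable),
    Measure.restrict_apply (measurableSet_lt measurable_const (by fun_prop))]
  refine le_trans (measure_mono ?_) (volume_stepsInto_le _ he ht)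
  rintro z ⟨hz, u, hu, hzu⟩
  refine ⟨u, hu, ?_, hzu⟩
  have h1 : |φ z - φ (z + u * e)| ≤ L * u := by
    have := hφ.dist_le_mul z (z + u * e)
    rwa [Real.dist_eq, dist_self_add_right, norm_mul, he, mul_one, Complex.norm_real,
      Real.norm_of_nonneg hu.1] at this
  have h2 : (L : ℝ) * u ≤ L * t := by gcongr; exact hu.2
  have h3 := le_abs_self (φ z - φ (z + u * e))
  simp only [Set.mem_ofPred_eq] at hz ⊢
  linarith

/-! ### The mollified indicator of an open set, and its gradient. -/

theorem _root_.IsPreconnected.inter_frontier_nonempty_of_mem_of_notMem {X : Type*}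
    [TopologicalSpace X] {S U : Set X} (hS : IsPreconnected S) {a b : X} (ha : a ∈ S) (hb : b ∈ S)
    (haU : a ∈ U) (hbU : b ∉ U) : (S ∩ frontier U).Nonempty := by
  by_contra h
  rw [Set.not_nonempty_iff_eq_empty] at h
  have hd : ∀ x ∈ S, x ∈ closure U → x ∈ interior U := fun x hx hc => by
    by_contra hi
    exact (Set.eq_empty_iff_forall_notMem.1 h x) ⟨hx, hc, hi⟩
  obtain ⟨x, -, hx1, hx2⟩ := hS (interior U) (closure U)ᶜ isOpen_interior
    isClosed_closure.isOpen_compl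
    (fun x hx => (em (x ∈ closure U)).imp (hd x hx) id)
    ⟨a, ha, hd a ha (subset_closure haU)⟩
    ⟨b, hb, fun hc => hbU (interior_subset (hd b hb hc))⟩
  exact hx2 (interior_subset_closure hx1)

theorem mem_stepsInto_frontier {U : Set ℂ} {z e : ℂ} {t : ℝ} (ht : 0 ≤ t)
    (h : ¬ (z ∈ U ↔ z + t * e ∈ U)) : z ∈ stepsInto (frontier U) e t := by
  have hS : IsPreconnected ((fun u : ℝ => z + u * e) '' Set.Icc 0 t) :=
    isPreconnected_Icc.image _ (by fun_prop)
  have h0 : z ∈ (fun u : ℝ => z + u * e) '' Set.Icc 0 t := ⟨0, ⟨le_rfl, ht⟩, by simp⟩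
  have h1 : z + t * e ∈ (fun u : ℝ => z + u * e) '' Set.Icc 0 t := ⟨t, ⟨ht, le_rfl⟩, rfl⟩
  have : (((fun u : ℝ => z + u * e) '' Set.Icc 0 t) ∩ frontier U).Nonempty := by
    by_cases hz : z ∈ U
    · exact hS.inter_frontier_nonempty_of_mem_of_notMem h0 h1 hz (by tauto)
    · exact hS.inter_frontier_nonempty_of_mem_of_notMem h1 h0 (by tauto) hz
  obtain ⟨_, ⟨u, hu, rfl⟩, hf⟩ := this
  exact ⟨u, hu, hf⟩

/-- The indicator function of `U`, mollified by the kernel `ρ`. -/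
noncomputable def mollify (U : Set ℂ) (ρ : ℂ → ℝ) : ℂ → ℝ :=
  convolution (U.indicator fun _ => (1 : ℝ)) ρ (ContinuousLinearMap.mul ℝ ℝ) volume

theorem mollify_apply (U : Set ℂ) (ρ : ℂ → ℝ) (x : ℂ) :
    mollify U ρ x = ∫ y, U.indicator (fun _ => (1 : ℝ)) y * ρ (x - y) := rfl

/-- After a change of variables, the difference is `ρ` integrated against the difference of two
indicators. That difference is at most `1` in modulus and vanishes unless the segment from `y` to `y
+ t * e` crosses the frontier. -/
theorem enorm_mollify_sub_le {U : Set ℂ} (hU : MeasurableSet U) {ρ : ℂ → ℝ} (h0 : ∀ z, 0 ≤ ρ z)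
    (hi : Integrable ρ) {x e : ℂ} {t : ℝ} (ht : 0 ≤ t) :
    ‖mollify U ρ (x + t * e) - mollify U ρ x‖ₑ ≤
      ∫⁻ y in stepsInto (frontier U) e t, ENNReal.ofReal (ρ (x - y)) := by
  have hi' : Integrable fun y => ρ (x - y) := hi.comp_sub_left x
  have hint : ∀ V : Set ℂ, MeasurableSet V →
      Integrable fun y => V.indicator (fun _ => (1 : ℝ)) y * ρ (x - y) := fun V hV => by
    have h : (fun y => V.indicator (fun _ => (1 : ℝ)) y * ρ (x - y)) =
        V.indicator fun y => ρ (x - y) := by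
      ext y; by_cases hy : y ∈ V <;> simp [hy]
    exact h ▸ hi'.indicator hV
  have h1 : mollify U ρ (x + t * e) =
      ∫ y : ℂ, ((fun y => y + t * e) ⁻¹' U).indicator (fun _ => (1 : ℝ)) y * ρ (x - y) := by
    rw [mollify_apply, ← integral_add_right_eq_self _ (t * e)]
    refine integral_congr_ae (.of_forall fun y => ?_)
    simp only [add_sub_add_right_eq_sub]
    rfl
  rw [h1, mollify_apply, ← integral_sub (hint _ (hU.preimage (by fun_prop))) (hint U hU)]
  refine (enorm_integral_le_lintegral_enorm _).trans ?_
  refine le_trans ?_ (lintegral_indicator_le _ _)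
  refine lintegral_mono fun y => ?_
  by_cases hy : y ∈ stepsInto (frontier U) e t
  · rw [Set.indicator_of_mem hy, ← sub_mul, enorm_mul, Real.enorm_of_nonneg (h0 _)]
    refine mul_le_of_le_one_left' ?_
    by_cases h2 : y ∈ U <;> by_cases h3 : y + t * e ∈ U <;> simp [h2, h3]
  · have h2 : (y ∈ U ↔ y + t * e ∈ U) := by
      by_contra h; exact hy (mem_stepsInto_frontier ht h)
    by_cases h3 : y + t * e ∈ U <;> simp [h2, h3]

/-- Each difference quotient is bounded by the sweeping estimate up to the error `L * t * H¹(∂U)`,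
which disappears as `t → 0` because the length is finite. -/
theorem enorm_fderiv_mollify_le {U : Set ℂ} (hU : MeasurableSet U)
    (hL : Measure.hausdorffMeasure 1 (frontier U) < (∞ : ℝ≥0∞))
    {ρ : ℂ → ℝ} (h0 : ∀ z, 0 ≤ ρ z)
    (hi : Integrable ρ) {L : NNReal} (hρ : LipschitzWith L ρ) {x : ℂ}
    (hd : DifferentiableAt ℝ (mollify U ρ) x) :
    ‖fderiv ℝ (mollify U ρ) x‖ₑ ≤
      ∫⁻ p in frontier U, ENNReal.ofReal (ρ (x - p)) ∂Measure.hausdorffMeasure 1 := by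
  set w := mollify U ρ
  set m := ∫⁻ p in frontier U, ENNReal.ofReal (ρ (x - p)) ∂Measure.hausdorffMeasure 1 with hm
  have hρx : LipschitzWith L fun y => ρ (x - y) := by
    have : LipschitzWith 1 fun y : ℂ => x - y := by
      refine LipschitzWith.of_dist_le_mul fun a b => ?_
      rw [dist_sub_left, NNReal.coe_one, one_mul]
    exact mul_one L ▸ hρ.comp this
  have key : ∀ e : ℂ, ‖e‖ = 1 → ‖fderiv ℝ w x e‖ₑ ≤ m := by
    intro e he
    have hlim : Tendsto (fun t : ℝ => ‖t⁻¹ • (w (x + t • e) - w x)‖ₑ) (𝓝[>] 0)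
        (𝓝 ‖fderiv ℝ w x e‖ₑ) :=
      ((hd.hasFDerivAt.hasLineDerivAt e).tendsto_slope_zero_right).enorm
    have hlim2 : Tendsto (fun t : ℝ => m + ENNReal.ofReal (L * t) *
        Measure.hausdorffMeasure 1 (frontier U)) (𝓝[>] 0) (𝓝 m) := by
      have : Tendsto (fun t : ℝ => m + ENNReal.ofReal (L * t) *
        Measure.hausdorffMeasure 1 (frontier U)) (𝓝 0) (𝓝 (m + ENNReal.ofReal (L * 0) *
        Measure.hausdorffMeasure 1 (frontier U))) := by
        refine tendsto_const_nhds.add (ENNReal.Tendsto.mul_const ?_ (Or.inr hL.ne))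
        exact ENNReal.tendsto_ofReal (tendsto_id.const_mul _)
      simp only [mul_zero, ENNReal.ofReal_zero, zero_mul, add_zero] at this
      exact this.mono_left nhdsWithin_le_nhds
    refine le_of_tendsto_of_tendsto hlim hlim2 ?_
    filter_upwards [self_mem_nhdsWithin] with t (ht : 0 < t)
    have h1 := (enorm_mollify_sub_le hU h0 hi (x := x) (e := e) ht.le).trans
      (lintegral_stepsInto_le (fun z => h0 _) hρx he ht)
    have h2 : ∫⁻ z in frontier U, ENNReal.ofReal (ρ (x - z) + L * t) ∂Measure.hausdorffMeasure 1
        ≤ m + ENNReal.ofReal (L * t) * Measure.hausdorffMeasure 1 (frontier U) := by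
      calc _ ≤ ∫⁻ z in frontier U, (ENNReal.ofReal (ρ (x - z)) + ENNReal.ofReal (L * t))
              ∂Measure.hausdorffMeasure 1 := lintegral_mono fun z => ENNReal.ofReal_add_le
        _ = _ := by
          rw [lintegral_add_right _ measurable_const, lintegral_const, Measure.restrict_apply_univ]
    rw [enorm_smul, Complex.real_smul]
    calc ‖t⁻¹‖ₑ * ‖w (x + t * e) - w x‖ₑ
        ≤ ‖t⁻¹‖ₑ * (ENNReal.ofReal t * (m + ENNReal.ofReal (L * t) *
            Measure.hausdorffMeasure 1 (frontier U))) := by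
          gcongr
          exact h1.trans (by gcongr)
      _ = _ := by
          rw [← mul_assoc, Real.enorm_of_nonneg (by positivity),
            ← ENNReal.ofReal_mul (by positivity), inv_mul_cancel₀ ht.ne', ENNReal.ofReal_one,
            one_mul]
  rcases eq_or_ne m ∞ with hmt | hmt
  · rw [hmt]; exact le_top
  rw [← ENNReal.ofReal_toReal hmt, ← ofReal_norm]
  refine ENNReal.ofReal_le_ofReal (ContinuousLinearMap.opNorm_le_of_unit_norm
    ENNReal.toReal_nonneg fun e he => ?_)
  have := key e he
  rwa [← ENNReal.ofReal_toReal hmt, ← ofReal_norm,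
    ENNReal.ofReal_le_ofReal_iff ENNReal.toReal_nonneg] at this

/-- `w` is the indicator mollified at scale `h`. Its gradient vanishes outside the `h`-thickening of
the frontier, and by Tonelli each boundary point contributes the mass `∫ ρ = 1` of the kernel, so
the total is the length. The weight `g` later plays the role of `‖f‖`. -/
theorem exists_cutoff {U : Set ℂ} (hU : IsOpen U) (hb : Bornology.IsBounded U)
    (hL : Measure.hausdorffMeasure 1 (frontier U) < (∞ : ℝ≥0∞)) {h : ℝ} (hh : 0 < h) :
    ∃ w : ℂ → ℝ, ContDiff ℝ 1 w ∧ HasCompactSupport w ∧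
      (∀ x, Metric.ball x h ⊆ U → w x = 1) ∧
      ∀ (g : ℂ → ℝ≥0∞) (C : ℝ≥0∞), (∀ x ∈ Metric.thickening h (frontier U), g x ≤ C) →
        ∫⁻ x, ‖fderiv ℝ w x‖ₑ * g x ≤ C * Measure.hausdorffMeasure 1 (frontier U) := by
  let b : ContDiffBump (0 : ℂ) := ⟨h / 2, h, by positivity, by linarith⟩
  set ρ : ℂ → ℝ := b.normed volume with hρ
  have hsupp : ∀ z, h ≤ ‖z‖ → ρ z = 0 := fun z hz => by
    have : z ∉ Function.support ρ := by
      rw [hρ, b.support_normed_eq]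
      simpa [b] using hz
    simpa using this
  have hc1 : ContDiff ℝ 1 ρ := b.contDiff_normed (n := 1)
  have hcs : HasCompactSupport ρ := b.hasCompactSupport_normed
  have h0 : ∀ z, 0 ≤ ρ z := fun z => b.nonneg_normed z
  have hi : Integrable ρ := b.integrable_normed
  obtain ⟨L, hLip⟩ := hc1.lipschitzWith_of_hasCompactSupport hcs one_ne_zero
  have hsm : ContDiff ℝ 1 (mollify U ρ) := by
    refine hcs.contDiff_convolution_right (n := 1) _ ?_ hc1
    exact (locallyIntegrable_const 1).indicator hU.measurableSet
  refine ⟨mollify U ρ, hsm, ?_, ?_, ?_⟩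
  · refine HasCompactSupport.convolution _ ?_ hcs
    refine HasCompactSupport.of_support_subset_isCompact hb.isCompact_closure ?_
    exact Set.support_indicator_subset.trans subset_closure
  · intro x hx
    have h1 : ∀ y, U.indicator (fun _ => (1 : ℝ)) y * ρ (x - y) = ρ (x - y) := fun y => by
      by_cases hy : y ∈ U
      · simp [hy]
      · rw [hsupp (x - y), mul_zero]
        by_contra! hlt
        exact hy (hx (by rwa [Metric.mem_ball, dist_comm, dist_eq_norm]))
    simp only [mollify_apply, h1]
    rw [integral_sub_left_eq_self ρ volume x]
    exact b.integral_normed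
  · intro g C hg
    set μ := (Measure.hausdorffMeasure 1 : Measure ℂ).restrict (frontier U) with hμ
    have : IsFiniteMeasure μ := ⟨by rwa [hμ, Measure.restrict_apply_univ]⟩
    calc ∫⁻ x, ‖fderiv ℝ (mollify U ρ) x‖ₑ * g x
        ≤ ∫⁻ x, (∫⁻ p, ENNReal.ofReal (ρ (x - p)) ∂μ) * C := by
          refine lintegral_mono fun x => ?_
          have h1 := enorm_fderiv_mollify_le hU.measurableSet hL h0 hi hLip
            (hsm.differentiable one_ne_zero x)
          by_cases hx : x ∈ Metric.thickening h (frontier U)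
          · exact mul_le_mul' h1 (hg x hx)
          · have h2 : ∫⁻ p in frontier U, ENNReal.ofReal (ρ (x - p))
                ∂Measure.hausdorffMeasure 1 = 0 := by
              rw [← lintegral_zero (μ := μ)]
              refine setLIntegral_congr_fun isClosed_frontier.measurableSet fun p hp => ?_
              rw [hsupp, ENNReal.ofReal_zero]
              by_contra! hlt
              exact hx (Metric.mem_thickening_iff.2 ⟨p, hp, by rwa [dist_eq_norm]⟩)
            rw [h2, nonpos_iff_eq_zero] at h1
            simp [h1]
      _ = (∫⁻ x, ∫⁻ p, ENNReal.ofReal (ρ (x - p)) ∂μ) * C := by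
          rw [lintegral_mul_const]
          have : Continuous ρ := hc1.continuous
          exact Measurable.lintegral_prod_right'
            (f := fun z : ℂ × ℂ => ENNReal.ofReal (ρ (z.1 - z.2))) (by fun_prop)
      _ = (∫⁻ p, ∫⁻ x, ENNReal.ofReal (ρ (x - p)) ∂volume ∂μ) * C := by
          have : Continuous ρ := hc1.continuous
          rw [lintegral_lintegral_swap]
          exact Measurable.aemeasurable (by simp only [Function.uncurry_def]; fun_prop)
      _ = C * Measure.hausdorffMeasure 1 (frontier U) := by
          have h3 : ∀ p, ∫⁻ x, ENNReal.ofReal (ρ (x - p)) = 1 := fun p => by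
            rw [lintegral_sub_right_eq_self (fun x => ENNReal.ofReal (ρ x)) p,
              ← ofReal_integral_eq_lintegral_ofReal hi (.of_forall h0), hρ, b.integral_normed,
              ENNReal.ofReal_one]
          simp only [h3, lintegral_one, hμ, Measure.restrict_apply_univ, mul_comm]

/-! ### Cutoffs and the Cauchy–Pompeiu form of contour integrals. -/

/-- Twice the Wirtinger derivative of `w` with respect to the conjugate variable. -/
noncomputable def dbar (w : ℂ → ℝ) (z : ℂ) : ℂ :=
  fderiv ℝ w z 1 + fderiv ℝ w z Complex.I * Complex.I

/-- `dbar w z` is the gradient of `w` read as a complex number; testing the derivative on this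
vector avoids the factor that the triangle inequality would lose. -/
theorem norm_dbar_le (w : ℂ → ℝ) (z : ℂ) : ‖dbar w z‖ ≤ ‖fderiv ℝ w z‖ := by
  set D := fderiv ℝ w z
  set v : ℂ := dbar w z with hv
  have hre : v.re = D 1 := by simp [hv, dbar, D]
  have him : v.im = D Complex.I := by simp [hv, dbar, D]
  have h1 : D v = ‖v‖ ^ 2 := by
    have : v = v.re • (1 : ℂ) + v.im • Complex.I := by
      simp [Complex.re_add_im]
    conv_lhs => rw [this, map_add, map_smul, map_smul, ← hre, ← him]
    rw [Complex.sq_norm, Complex.normSq_apply, smul_eq_mul, smul_eq_mul]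
  have h2 := D.le_opNorm v
  rw [h1, Real.norm_of_nonneg (by positivity)] at h2
  rcases (norm_nonneg v).eq_or_lt with h | h
  · rw [← h]; positivity
  · nlinarith

theorem dbar_eq_zero_of_eventuallyEq_const {w : ℂ → ℝ} {z : ℂ} {c : ℝ}
    (h : w =ᶠ[𝓝 z] fun _ => c) : dbar w z = 0 := by
  simp [dbar, h.fderiv_eq]

theorem continuous_dbar {w : ℂ → ℝ} (hw : ContDiff ℝ 1 w) : Continuous (dbar w) := by
  have := hw.continuous_fderiv one_ne_zero
  unfold dbar
  fun_prop

theorem hasCompactSupport_dbar {w : ℂ → ℝ} (hw : HasCompactSupport w) :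
    HasCompactSupport (dbar w) := by
  refine (hw.fderiv (𝕜 := ℝ)).mono fun z hz => ?_
  contrapose! hz
  simp only [Function.mem_support, not_not] at hz ⊢
  simp [dbar, hz]

section Dbar

variable {E : Type*} [NormedAddCommGroup E] [NormedSpace ℂ E]

theorem continuous_dbar_smul {w : ℂ → ℝ} (hw : ContDiff ℝ 1 w) {f : ℂ → E}
    (hf : ∀ z, ContinuousAt f z ∨ ∃ c : ℝ, w =ᶠ[𝓝 z] fun _ => c) :
    Continuous fun z => dbar w z • f z := by
  refine continuous_iff_continuousAt.2 fun z => ?_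
  rcases hf z with h | ⟨c, h⟩
  · exact (continuous_dbar hw).continuousAt.smul h
  · have : (fun z => dbar w z • f z) =ᶠ[𝓝 z] fun _ => 0 := by
      filter_upwards [h.eventuallyEq_nhds] with x hx
      rw [dbar_eq_zero_of_eventuallyEq_const hx, zero_smul]
    exact continuousAt_const.congr this.symm

theorem integral_fderiv_apply_eq_zero {g : ℂ → E} (hg : ContDiff ℝ 1 g)
    (hc : HasCompactSupport g) (v : ℂ) : ∫ z, fderiv ℝ g z v = 0 := by
  have h1 : Integrable fun z => fderiv ℝ g z v := by
    refine Continuous.integrable_of_hasCompactSupport ?_ (hc.fderiv_apply (𝕜 := ℝ) v)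
    have := hg.continuous_fderiv one_ne_zero
    fun_prop
  have := integral_smul_fderiv_eq_neg_fderiv_smul_of_integrable (𝕜 := ℝ) (f := fun _ : ℂ => (1 : ℝ))
    (g := g) (v := v) (μ := volume) (by simp) (by simpa using h1)
    (by simpa using hg.continuous.integrable_of_hasCompactSupport hc)
    (fun x _ => by fun_prop) (fun x _ => hg.differentiable one_ne_zero x)
  simpa using this

/-- `(w₁ - w₂) • f` is `C¹` with compact support, since the difference vanishes near every point
where `f` is not analytic. Its `∂̄` derivative integrates to zero and, by the Cauchy–Riemann
equation for `f`, equals the difference of the integrands. -/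
theorem integral_dbar_smul_eq [CompleteSpace E] {w₁ w₂ : ℂ → ℝ} (h₁ : ContDiff ℝ 1 w₁) (h₂ : ContDiff ℝ 1 w₂)
    (hc₁ : HasCompactSupport w₁) (hc₂ : HasCompactSupport w₂) {f : ℂ → E}
    (hf : ∀ z, AnalyticAt ℂ f z ∨ (w₁ =ᶠ[𝓝 z] fun _ => 1) ∧ w₂ =ᶠ[𝓝 z] fun _ => 1) :
    ∫ z, dbar w₁ z • f z = ∫ z, dbar w₂ z • f z := by
  have hi : ∀ w : ℂ → ℝ, ContDiff ℝ 1 w → HasCompactSupport w →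
      (∀ z, AnalyticAt ℂ f z ∨ w =ᶠ[𝓝 z] fun _ => 1) → Integrable fun z => dbar w z • f z := by
    intro w hw hc h
    refine (continuous_dbar_smul hw fun z => ?_).integrable_of_hasCompactSupport
      (hasCompactSupport_dbar hc).smul_right
    exact (h z).imp (fun h => h.continuousAt) fun h => ⟨1, h⟩
  set g : ℂ → E := fun z => (w₁ z - w₂ z) • f z with hg
  have hz : ∀ z, (w₁ =ᶠ[𝓝 z] fun _ => 1) ∧ (w₂ =ᶠ[𝓝 z] fun _ => 1) → g =ᶠ[𝓝 z] fun _ => 0 := by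
    rintro z ⟨ha, hb⟩
    filter_upwards [ha, hb] with x hxa hxb
    simp [hg, hxa, hxb]
  have hgC : ContDiff ℝ 1 g := by
    refine contDiff_iff_contDiffAt.2 fun z => ?_
    rcases hf z with h | h
    · exact (h₁.sub h₂).contDiffAt.smul (h.contDiffAt.restrict_scalars ℝ)
    · exact contDiffAt_const.congr_of_eventuallyEq (hz z h)
  have hgc : HasCompactSupport g := (hc₁.sub hc₂).smul_right
  rw [← sub_eq_zero, ← integral_sub (hi _ h₁ hc₁ fun z => (hf z).imp id And.left)
    (hi _ h₂ hc₂ fun z => (hf z).imp id And.right)]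
  have key : ∀ z, dbar w₁ z • f z - dbar w₂ z • f z =
      fderiv ℝ g z 1 + Complex.I • fderiv ℝ g z Complex.I := by
    intro z
    rcases hf z with h | h
    · have hfd := (h.differentiableAt.hasFDerivAt).restrictScalars ℝ
      have hd := ((h₁.differentiable one_ne_zero z).hasFDerivAt.sub
        (h₂.differentiable one_ne_zero z).hasFDerivAt).smul hfd
      have hd' : HasFDerivAt g _ z := hd
      rw [hd'.fderiv]
      have hI : (fderiv ℂ f z) Complex.I = Complex.I • fderiv ℂ f z 1 := by
        rw [← map_smul, smul_eq_mul, mul_one]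
      simp only [dbar, add_apply, smul_apply,
        ContinuousLinearMap.smulRight_apply, sub_apply,
        ContinuousLinearMap.coe_restrictScalars', hI]
      simp only [← Complex.coe_smul, smul_add, smul_smul]
      rw [show ∀ a b c d : E, a + b + (c + d) = (a + c) + (b + d) from fun a b c d => by abel,
        ← add_smul, ← add_smul, ← sub_smul]
      have : ((↑((w₁ - w₂) z) : ℂ) + Complex.I * (↑((w₁ - w₂) z) * Complex.I)) = 0 := by
        linear_combination (↑((w₁ - w₂) z) : ℂ) * Complex.I_mul_I
      rw [this, zero_smul, zero_add]
      congr 1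
      push_cast
      ring
    · rw [dbar_eq_zero_of_eventuallyEq_const h.1, dbar_eq_zero_of_eventuallyEq_const h.2,
        (hz z h).fderiv_eq]
      simp
  simp only [key]
  have hint : ∀ v, Integrable fun z => fderiv ℝ g z v := fun v => by
    refine Continuous.integrable_of_hasCompactSupport ?_ (hgc.fderiv_apply (𝕜 := ℝ) v)
    have := hgC.continuous_fderiv one_ne_zero
    fun_prop
  have hI : Integrable fun z => Complex.I • fderiv ℝ g z Complex.I :=
    (hint Complex.I).smul Complex.I
  rw [integral_add (hint 1) hI, integral_smul,
    integral_fderiv_apply_eq_zero hgC hgc, integral_fderiv_apply_eq_zero hgC hgc]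
  simp

/-- A smooth radial function which is `1` on the disk of radius `r` and has compact support. -/
noncomputable def radialCutoff (r : ℝ) (z : ℂ) : ℝ :=
  1 - Real.smoothTransition (z.re ^ 2 + z.im ^ 2 - r ^ 2)

theorem norm_sq_eq_re_add_im (z : ℂ) : z.re ^ 2 + z.im ^ 2 = ‖z‖ ^ 2 := by
  rw [Complex.sq_norm, Complex.normSq_apply]; ring

theorem contDiff_radialCutoff (r : ℝ) : ContDiff ℝ 1 (radialCutoff r) := by
  have h1 : ContDiff ℝ 1 Real.smoothTransition := Real.smoothTransition.contDiff
  have hre : ContDiff ℝ 1 Complex.re := Complex.reCLM.contDiff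
  have him : ContDiff ℝ 1 Complex.im := Complex.imCLM.contDiff
  exact contDiff_const.sub (h1.comp (((hre.pow 2).add (him.pow 2)).sub contDiff_const))

theorem radialCutoff_eq_one {r : ℝ} {z : ℂ} (h : ‖z‖ ≤ r) : radialCutoff r z = 1 := by
  rw [radialCutoff, norm_sq_eq_re_add_im, Real.smoothTransition.zero_of_nonpos, sub_zero]
  have := norm_nonneg z
  nlinarith

theorem hasCompactSupport_radialCutoff {r : ℝ} (hr : 0 ≤ r) :
    HasCompactSupport (radialCutoff r) := by
  refine HasCompactSupport.of_support_subset_isCompact (isCompact_closedBall (0 : ℂ) (r + 1)) ?_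
  intro z hz
  rw [mem_closedBall_zero_iff]
  contrapose! hz
  rw [Function.mem_support, not_not, radialCutoff, norm_sq_eq_re_add_im,
    Real.smoothTransition.one_of_one_le, sub_self]
  nlinarith

theorem dbar_radialCutoff (r : ℝ) (z : ℂ) :
    dbar (radialCutoff r) z = -(2 * deriv Real.smoothTransition (‖z‖ ^ 2 - r ^ 2) : ℝ) * z := by
  have h1 : HasDerivAt Real.smoothTransition
      (deriv Real.smoothTransition (z.re ^ 2 + z.im ^ 2 - r ^ 2)) (z.re ^ 2 + z.im ^ 2 - r ^ 2) :=
    ((Real.smoothTransition.contDiff (n := 1)).differentiable one_ne_zero _).hasDerivAt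
  have hre : HasFDerivAt Complex.re Complex.reCLM z := Complex.reCLM.hasFDerivAt
  have him : HasFDerivAt Complex.im Complex.imCLM z := Complex.imCLM.hasFDerivAt
  have h2 := (h1.comp_hasFDerivAt z (((hre.pow 2).add (him.pow 2)).sub_const (r ^ 2))).const_sub 1
  have h3 : HasFDerivAt (radialCutoff r) _ z := h2
  rw [dbar, h3.fderiv, ← norm_sq_eq_re_add_im]
  apply Complex.ext <;> simp <;> ring

theorem continuous_deriv_smoothTransition : Continuous (deriv Real.smoothTransition) :=
  (Real.smoothTransition.contDiff (n := 1)).continuous_deriv le_rfl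

theorem deriv_smoothTransition_eq_zero {x : ℝ} (hx : x < 0) : deriv Real.smoothTransition x = 0 := by
  have : Real.smoothTransition =ᶠ[𝓝 x] fun _ => 0 := by
    filter_upwards [gt_mem_nhds hx] with y hy
    exact Real.smoothTransition.zero_of_nonpos hy.le
  simp [this.deriv_eq]

theorem integral_deriv_smoothTransition_sq {r : ℝ} (hr : 0 ≤ r) :
    ∫ s in 0..(r + 1), 2 * s * deriv Real.smoothTransition (s ^ 2 - r ^ 2) = 1 := by
  have h1 : ∀ s : ℝ, HasDerivAt (fun s => Real.smoothTransition (s ^ 2 - r ^ 2))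
      (2 * s * deriv Real.smoothTransition (s ^ 2 - r ^ 2)) s := fun s => by
    have h := ((Real.smoothTransition.contDiff (n := 1)).differentiable one_ne_zero
      (s ^ 2 - r ^ 2)).hasDerivAt
    have h2 : HasDerivAt (fun s : ℝ => s ^ 2 - r ^ 2) (2 * s) s := by
      simpa using ((hasDerivAt_id s).pow 2).sub_const (r ^ 2)
    have := h.comp s h2
    rwa [mul_comm] at this
  have hc := continuous_deriv_smoothTransition
  rw [intervalIntegral.integral_eq_sub_of_hasDerivAt (fun s _ => h1 s)
    (Continuous.intervalIntegrable (by fun_prop) _ _),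
    Real.smoothTransition.one_of_one_le (by nlinarith),
    Real.smoothTransition.zero_of_nonpos (by nlinarith), sub_zero]

/-- In polar coordinates the integrand on the circle of radius `s` is the contour integrand times a
weight depending only on `s`. The circle integrals for `s > r₀` agree, and the weights integrate to
`-1`. -/
theorem integral_dbar_radialCutoff_smul [CompleteSpace E] {r₀ r : ℝ} (h0 : 0 ≤ r₀) (hr : r₀ < r)
    {f : ℂ → E} (hf : ∀ z, r₀ < ‖z‖ → ContinuousAt f z) {c : E}
    (hc : ∀ s, r₀ < s →
      ∫ θ in (-Real.pi)..Real.pi, circleMap 0 s θ • f (circleMap 0 s θ) = (2 * Real.pi) • c) :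
    ∫ z, dbar (radialCutoff r) z • f z = -((2 * Real.pi) • c) := by
  set F : ℂ → E := fun z => dbar (radialCutoff r) z • f z with hF
  have hFc : Continuous F := by
    refine continuous_dbar_smul (contDiff_radialCutoff r) fun z => ?_
    rcases lt_or_ge r₀ ‖z‖ with h | h
    · exact .inl (hf z h)
    · refine .inr ⟨1, ?_⟩
      filter_upwards [continuous_norm.continuousAt.eventually (gt_mem_nhds (h.trans_lt hr))] with x hx
      exact radialCutoff_eq_one hx.le
  -- The radius `r + 1` suffices because `(r + 1) ^ 2 - r ^ 2 ≥ 1`, where the transition has reached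
  -- `1`.
  have hF0 : ∀ z, r + 1 < ‖z‖ → F z = 0 := fun z hz => by
    have : radialCutoff r =ᶠ[𝓝 z] fun _ => 0 := by
      filter_upwards [continuous_norm.continuousAt.eventually (lt_mem_nhds hz)] with x hx
      rw [radialCutoff, norm_sq_eq_re_add_im, Real.smoothTransition.one_of_one_le, sub_self]
      nlinarith
    simp [hF, dbar_eq_zero_of_eventuallyEq_const this]
  have hcm : ∀ p : ℝ × ℝ, Complex.polarCoord.symm p = circleMap 0 p.1 p.2 := fun p => by
    rw [Complex.polarCoord_symm_apply, circleMap, Complex.exp_mul_I, zero_add, Complex.ofReal_cos,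
      Complex.ofReal_sin]
  have hG : Continuous fun p : ℝ × ℝ => p.1 • F (circleMap 0 p.1 p.2) := by
    have : Continuous fun p : ℝ × ℝ => circleMap 0 p.1 p.2 := by
      unfold circleMap; fun_prop
    exact continuous_fst.smul (hFc.comp this)
  set S : Set (ℝ × ℝ) := Set.Ioc 0 (r + 1) ×ˢ Set.Ioo (-Real.pi) Real.pi with hS
  rw [← Complex.integral_comp_polarCoord_symm]
  simp only [hcm]
  have h1 : ∫ p in polarCoord.target, p.1 • F (circleMap 0 p.1 p.2) =
      ∫ s in Set.Ioc 0 (r + 1), ∫ θ in Set.Ioc (-Real.pi) Real.pi, s • F (circleMap 0 s θ) := by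
    have hST : S ⊆ polarCoord.target := Set.prod_mono_left Set.Ioc_subset_Ioi_self
    rw [setIntegral_eq_of_subset_of_forall_sdiff_eq_zero polarCoord.open_target.measurableSet hST,
      hS, Measure.volume_eq_prod, setIntegral_prod]
    · simp only [integral_Ioc_eq_integral_Ioo]
    · rw [← Measure.volume_eq_prod]
      refine (hG.continuousOn.integrableOn_compact
        (isCompact_Icc.prod (isCompact_Icc (a := -Real.pi) (b := Real.pi)))).mono_set
        (Set.prod_mono Set.Ioc_subset_Icc_self Set.Ioo_subset_Icc_self)
    · rintro p ⟨⟨hp1, hp2⟩, hpS⟩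
      have hp1' : 0 < p.1 := hp1
      have : r + 1 < p.1 := by
        by_contra! hle
        exact hpS ⟨⟨hp1', hle⟩, hp2⟩
      rw [hF0, smul_zero]
      rwa [norm_circleMap_zero, abs_of_pos hp1']
  rw [h1]
  have h2 : ∀ s ∈ Set.Ioc 0 (r + 1), ∫ θ in Set.Ioc (-Real.pi) Real.pi, s • F (circleMap 0 s θ) =
      (2 * s * deriv Real.smoothTransition (s ^ 2 - r ^ 2)) • -((2 * Real.pi) • c) := by
    intro s hs
    have h3 : ∀ θ, s • F (circleMap 0 s θ) =
        -(2 * s * deriv Real.smoothTransition (s ^ 2 - r ^ 2)) •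
          (circleMap 0 s θ • f (circleMap 0 s θ)) := fun θ => by
      simp only [hF, dbar_radialCutoff, norm_circleMap_zero, sq_abs, ← Complex.coe_smul, smul_smul]
      congr 1
      push_cast
      ring
    simp only [h3]
    rw [integral_smul, ← intervalIntegral.integral_of_le (by linarith [Real.pi_pos])]
    rcases lt_or_ge r₀ s with h | h
    · rw [hc s h, neg_smul, smul_neg]
    · rw [deriv_smoothTransition_eq_zero (by nlinarith [hs.1])]
      simp
  rw [setIntegral_congr_fun measurableSet_Ioc h2, integral_smul_const,
    ← intervalIntegral.integral_of_le (by linarith), integral_deriv_smoothTransition_sq (by linarith),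
    one_smul]

end Dbar

/-! ### The boundary estimate for contour integrals. -/

/-- The contour integral estimate `‖∫_{∂U} f dz‖ ≤ sup_{∂U} ‖f‖ · H¹(∂U)` for an open set `U` that
contains all singularities of `f`, the contour integral being computed on large circles. -/
theorem enorm_le_of_frontier {E : Type*} [NormedAddCommGroup E] [NormedSpace ℂ E] [CompleteSpace E]
    {U : Set ℂ} (hU : IsOpen U) (hb : Bornology.IsBounded U)
    (hL : Measure.hausdorffMeasure 1 (frontier U) < (∞ : ℝ≥0∞)) {f : ℂ → E}
    (hf : ∀ z ∉ U, AnalyticAt ℂ f z) {C : ℝ} (hC : ∀ z ∈ frontier U, ‖f z‖ ≤ C)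
    {r₀ : ℝ} (h0 : 0 ≤ r₀) (hr₀ : ∀ z, r₀ < ‖z‖ → AnalyticAt ℂ f z) {c : E}
    (hc : ∀ s, r₀ < s →
      ∫ θ in (-Real.pi)..Real.pi, circleMap 0 s θ • f (circleMap 0 s θ) = (2 * Real.pi) • c) :
    ‖(2 * Real.pi) • c‖ₑ ≤ ENNReal.ofReal C * Measure.hausdorffMeasure 1 (frontier U) := by
  set P : Set ℂ := {z | AnalyticAt ℂ f z}ᶜ with hP
  have hPU : P ⊆ U := fun z hz => by_contra fun h => hz (hf z h)
  have hPc : IsCompact P :=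
    Metric.isCompact_of_isClosed_isBounded (isOpen_analyticAt ℂ f).isClosed_compl (hb.subset hPU)
  have hKc : IsCompact (frontier U) :=
    hb.isCompact_closure.of_isClosed_subset isClosed_frontier frontier_subset_closure
  have hKU : ∀ z ∈ frontier U, z ∉ U := fun z hz h => by
    rw [hU.frontier_eq] at hz; exact hz.2 h
  obtain ⟨h₂, hh₂, hsub₂⟩ := hPc.exists_thickening_subset_open hU hPU
  have key : ∀ η : ℝ, 0 < η → ‖(2 * Real.pi) • c‖ₑ ≤
      ENNReal.ofReal (C + η) * Measure.hausdorffMeasure 1 (frontier U) := by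
    intro η hη
    have hV : IsOpen ({z | AnalyticAt ℂ f z} ∩ (fun z => ‖f z‖) ⁻¹' Set.Iio (C + η)) := by
      refine ContinuousOn.isOpen_inter_preimage (fun z hz => ?_) (isOpen_analyticAt ℂ f) isOpen_Iio
      exact (AnalyticAt.continuousAt hz).norm.continuousWithinAt
    obtain ⟨h₁, hh₁, hsub₁⟩ := hKc.exists_thickening_subset_open hV fun z hz =>
      ⟨hf z (hKU z hz), (hC z hz).trans_lt (by linarith)⟩
    -- `h₁` keeps `‖f‖ < C + η` where the gradient of the cutoff lives. With `h₂ / 2`, an `h`-ball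
    -- about any point within `h₂ / 2` of a singularity stays in `U`, so the cutoff is `1` near the
    -- singularities.
    set h := min h₁ (h₂ / 2)
    have hh : 0 < h := lt_min hh₁ (by positivity)
    obtain ⟨w, hw, hwc, hw1, hwi⟩ := exists_cutoff hU hb hL hh
    have hwP : ∀ z ∈ P, w =ᶠ[𝓝 z] fun _ => 1 := by
      intro z hz
      filter_upwards [Metric.ball_mem_nhds z (half_pos hh₂)] with x hx
      refine hw1 x fun y hy => hsub₂ (Metric.mem_thickening_iff.2 ⟨z, hz, ?_⟩)
      have h3 : dist y x < h₂ / 2 := (Metric.mem_ball.1 hy).trans_le (min_le_right _ _)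
      have h4 : dist x z < h₂ / 2 := hx
      linarith [dist_triangle y x z]
    have hrP : ∀ z ∈ P, radialCutoff (r₀ + 1) =ᶠ[𝓝 z] fun _ => 1 := by
      intro z hz
      have hzr : ‖z‖ < r₀ + 1 := by
        by_contra! hle
        exact hz (hr₀ z (by linarith))
      filter_upwards [continuous_norm.continuousAt.eventually (gt_mem_nhds hzr)] with x hx
      exact radialCutoff_eq_one hx.le
    have h5 := integral_dbar_radialCutoff_smul h0 (lt_add_one r₀)
      (fun z hz => (hr₀ z hz).continuousAt) hc
    rw [integral_dbar_smul_eq (contDiff_radialCutoff _) hw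
      (hasCompactSupport_radialCutoff (by linarith)) hwc
      fun z => (em (AnalyticAt ℂ f z)).imp id fun hz => ⟨hrP z hz, hwP z hz⟩] at h5
    rw [← enorm_neg, ← h5]
    calc ‖∫ z, dbar w z • f z‖ₑ ≤ ∫⁻ z, ‖dbar w z • f z‖ₑ := enorm_integral_le_lintegral_enorm _
      _ ≤ ∫⁻ z, ‖fderiv ℝ w z‖ₑ * ‖f z‖ₑ := by
          refine lintegral_mono fun z => ?_
          rw [enorm_smul]
          gcongr
          rw [← ofReal_norm, ← ofReal_norm]
          exact ENNReal.ofReal_le_ofReal (norm_dbar_le w z)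
      _ ≤ _ := hwi _ _ fun x hx => by
          rw [← ofReal_norm]
          exact ENNReal.ofReal_le_ofReal
            (hsub₁ (Metric.thickening_mono (min_le_left _ _) _ hx)).2.le
  refine ge_of_tendsto (x := 𝓝[>] (0 : ℝ)) (f := fun η => ENNReal.ofReal (C + η) *
    Measure.hausdorffMeasure 1 (frontier U)) ?_ (eventually_nhdsWithin_of_forall key)
  have : Tendsto (fun η => ENNReal.ofReal (C + η) * Measure.hausdorffMeasure 1 (frontier U)) (𝓝 0)
      (𝓝 (ENNReal.ofReal (C + 0) * Measure.hausdorffMeasure 1 (frontier U))) :=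
    ENNReal.Tendsto.mul_const (ENNReal.tendsto_ofReal (tendsto_const_nhds.add tendsto_id))
      (Or.inr hL.ne)
  rw [add_zero] at this
  exact this.mono_left nhdsWithin_le_nhds

/-! ### The resolvent of an algebraic element as a rational function. -/

section Algebra

variable {𝒜 : Type*} [Ring 𝒜] [Algebra ℂ 𝒜]

/-- If `q(a) = 0`, then this is `q(z) (z - a)⁻¹`, written as a polynomial in `z`. -/
def resolventNumerator (a : 𝒜) (q : Polynomial ℂ) (z : ℂ) : 𝒜 :=
  ∑ m ∈ Finset.range (q.natDegree + 1),
    q.coeff m • ∑ i ∈ Finset.range m, z ^ i • a ^ (m - 1 - i)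

theorem sub_mul_resolventNumerator (a : 𝒜) (q : Polynomial ℂ) (z : ℂ) :
    (algebraMap ℂ 𝒜 z - a) * resolventNumerator a q z =
      algebraMap ℂ 𝒜 (q.eval z) - Polynomial.aeval a q := by
  have hcomm : Commute (algebraMap ℂ 𝒜 z) a := Algebra.commutes z a
  rw [resolventNumerator, Finset.mul_sum, Polynomial.eval_eq_sum_range,
    Polynomial.aeval_eq_sum_range, map_sum, ← Finset.sum_sub_distrib]
  refine Finset.sum_congr rfl fun m _ => ?_
  have : ∑ i ∈ Finset.range m, z ^ i • a ^ (m - 1 - i) =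
      ∑ i ∈ Finset.range m, algebraMap ℂ 𝒜 z ^ i * a ^ (m - 1 - i) :=
    Finset.sum_congr rfl fun i _ => by rw [← map_pow, Algebra.smul_def]
  rw [mul_smul_comm, this, hcomm.mul_geom_sum₂, smul_sub, Algebra.smul_def, map_mul, map_pow]

theorem commute_resolventNumerator (a : 𝒜) (q : Polynomial ℂ) (z : ℂ) :
    Commute (algebraMap ℂ 𝒜 z - a) (resolventNumerator a q z) := by
  refine Commute.sum_right _ _ _ fun m _ => Commute.smul_right (Commute.sum_right _ _ _ fun i _ =>
    Commute.smul_right (Commute.pow_right ?_ _) _) _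
  exact Commute.sub_left (Algebra.commutes z a) (Commute.refl a)

theorem resolvent_eq_resolventNumerator {a : 𝒜} {q : Polynomial ℂ} (hq : Polynomial.aeval a q = 0)
    {z : ℂ} (hz : q.eval z ≠ 0) : resolvent a z = (q.eval z)⁻¹ • resolventNumerator a q z := by
  have h1 := sub_mul_resolventNumerator a q z
  rw [hq, sub_zero] at h1
  have h2 : (algebraMap ℂ 𝒜 z - a) * ((q.eval z)⁻¹ • resolventNumerator a q z) = 1 := by
    rw [mul_smul_comm, h1, Algebra.smul_def, ← map_mul, inv_mul_cancel₀ hz, map_one]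
  have h3 : ((q.eval z)⁻¹ • resolventNumerator a q z) * (algebraMap ℂ 𝒜 z - a) = 1 := by
    rw [smul_mul_assoc, ← (commute_resolventNumerator a q z).eq, h1, Algebra.smul_def, ← map_mul,
      inv_mul_cancel₀ hz, map_one]
  exact Ring.inverse_unit ⟨_, _, h2, h3⟩

end Algebra

/-! ### Meromorphy of the resolvent and its Laurent coefficients at infinity. -/

section Banach

variable {𝒜 : Type*} [NormedRing 𝒜] [NormedAlgebra ℂ 𝒜]
  {E : Type*} [NormedAddCommGroup E] [NormedSpace ℂ E]

theorem analyticAt_resolventNumerator (a : 𝒜) (q : Polynomial ℂ) (z : ℂ) :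
    AnalyticAt ℂ (resolventNumerator a q) z := by
  unfold resolventNumerator
  refine Finset.analyticAt_fun_sum _ fun m _ => AnalyticAt.fun_const_smul ?_
  refine Finset.analyticAt_fun_sum _ fun i _ => ?_
  exact (analyticAt_id.pow i).smul analyticAt_const

theorem eventually_eval_ne_zero {q : Polynomial ℂ} (hq : q ≠ 0) (z : ℂ) :
    ∀ᶠ w in 𝓝[≠] z, q.eval w ≠ 0 := by
  have hfin : {w | q.eval w = 0}.Finite := by
    simpa [Polynomial.IsRoot] using Polynomial.finite_setOfPred_isRoot hq
  have := (hfin.sdiff (t := {z})).isClosed.isOpen_compl.mem_nhds (x := z) (by simp)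
  filter_upwards [nhdsWithin_le_nhds this, self_mem_nhdsWithin] with w hw hne h0
  exact hw ⟨h0, hne⟩

theorem meromorphicAt_apply_resolvent {a : 𝒜} {q : Polynomial ℂ} (hq : q ≠ 0)
    (hqa : Polynomial.aeval a q = 0) (Φ : 𝒜 →L[ℂ] E) (z : ℂ) :
    MeromorphicAt (fun z => Φ (resolvent a z)) z := by
  have h1 : MeromorphicAt ((fun z => q.eval z)⁻¹ • fun z => Φ (resolventNumerator a q z)) z :=
    (q.differentiable.analyticAt z).meromorphicAt.inv.smul
      ((Φ.analyticAt _).comp (analyticAt_resolventNumerator a q z)).meromorphicAt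
  refine h1.congr ?_
  filter_upwards [eventually_eval_ne_zero hq z] with w hw
  rw [resolvent_eq_resolventNumerator hqa hw, map_smul]
  rfl

variable [CompleteSpace 𝒜]

theorem hasSum_resolvent (a : 𝒜) {z : ℂ} (hz : ‖a‖ < ‖z‖) :
    HasSum (fun m : ℕ => (z⁻¹) ^ (m + 1) • a ^ m) (resolvent a z) := by
  have hz0 : z ≠ 0 := norm_pos_iff.1 ((norm_nonneg a).trans_lt hz)
  have h1 : ‖z⁻¹ • a‖ < 1 := by
    rw [norm_smul, norm_inv, inv_mul_lt_iff₀ (norm_pos_iff.2 hz0), mul_one]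
    exact hz
  have h2 := (hasSum_geom_series_inverse _ h1).const_smul z⁻¹
  have h3 : resolvent a z = z⁻¹ • Ring.inverse (1 - z⁻¹ • a) := by
    have := spectrum.units_smul_resolvent (r := Units.mk0 z hz0) (s := z) (a := a)
    simp only [Units.smul_def, Units.val_mk0, Units.val_inv_eq_inv_val, smul_eq_mul,
      inv_mul_cancel₀ hz0, resolvent, map_one] at this
    rw [resolvent, ← this, smul_smul, inv_mul_cancel₀ hz0, one_smul]
  rw [h3]
  convert h2 using 2 with m
  rw [smul_pow, smul_smul, pow_succ']

theorem integral_circleMap_zpow (s : ℝ) (k : ℤ) :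
    ∫ θ in (-Real.pi)..Real.pi, circleMap 0 s θ ^ k = if k = 0 then 2 * Real.pi else 0 := by
  split_ifs with h
  · simp [h]; ring
  · have h1 : ∀ θ : ℝ, circleMap 0 s θ ^ k = (s : ℂ) ^ k * Complex.exp (k * Complex.I * θ) := by
      intro θ
      rw [circleMap, zero_add, mul_zpow, ← Complex.exp_int_mul]
      congr 2
      ring
    have h2 : (k : ℂ) * Complex.I ≠ 0 := by simp [h]
    simp only [h1]
    rw [intervalIntegral.integral_const_mul, integral_exp_mul_complex h2]
    have h3 : Complex.exp (k * Complex.I * (Real.pi : ℝ)) =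
        Complex.exp (k * Complex.I * ((-Real.pi : ℝ) : ℂ)) := by
      rw [Complex.exp_eq_exp_iff_exists_int]
      exact ⟨k, by push_cast; ring⟩
    rw [h3]; simp

/-- Integrate the Neumann series term by term: only the term `m = n` has a nonzero mean over the
circle. -/
theorem integral_circleMap_resolvent (a : 𝒜) (Φ : 𝒜 →L[ℂ] E) [CompleteSpace E] (n : ℕ) {s : ℝ}
    (hs : ‖a‖ < s) :
    ∫ θ in (-Real.pi)..Real.pi, circleMap 0 s θ • circleMap 0 s θ ^ n •
      Φ (resolvent a (circleMap 0 s θ)) = (2 * Real.pi) • Φ (a ^ n) := by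
  have hs0 : 0 < s := (norm_nonneg a).trans_lt hs
  have hne : ∀ θ, circleMap 0 s θ ≠ 0 := fun θ => circleMap_ne_center hs0.ne'
  have hnorm : ∀ θ, ‖circleMap 0 s θ‖ = s := fun θ => by
    rw [norm_circleMap_zero, abs_of_pos hs0]
  -- `‖1‖ = 1` is not assumed, so the power `m = 0` needs its own constant.
  set K := max 1 ‖(1 : 𝒜)‖
  have hpow : ∀ m, ‖a ^ m‖ ≤ K * ‖a‖ ^ m := by
    intro m
    rcases Nat.eq_zero_or_pos m with rfl | hm
    · simp [K]
    · exact (norm_pow_le' a hm).trans (le_mul_of_one_le_left (by positivity) (le_max_left _ _))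
  have hsum := intervalIntegral.hasSum_integral_of_dominated_convergence (μ := volume)
    (a := -Real.pi) (b := Real.pi)
    (F := fun (m : ℕ) θ => circleMap 0 s θ ^ ((n : ℤ) - m) • Φ (a ^ m))
    (f := fun θ => circleMap 0 s θ • circleMap 0 s θ ^ n • Φ (resolvent a (circleMap 0 s θ)))
    (fun m _ => s ^ n * ‖Φ‖ * K * (‖a‖ / s) ^ m) ?_ ?_ ?_ ?_ ?_
  · have h1 : ∀ m : ℕ, ∫ θ in (-Real.pi)..Real.pi, circleMap 0 s θ ^ ((n : ℤ) - m) • Φ (a ^ m) =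
        if m = n then (2 * Real.pi) • Φ (a ^ n) else 0 := by
      intro m
      rw [intervalIntegral.integral_smul_const, integral_circleMap_zpow s]
      by_cases hm : m = n
      · subst hm
        simp [← Complex.coe_smul]
      · have : ¬ ((n : ℤ) - m = 0) := by omega
        simp [hm, this]
    simp only [h1] at hsum
    exact hsum.unique (hasSum_ite_eq n _)
  · intro m
    refine Continuous.aestronglyMeasurable ?_
    refine Continuous.smul ?_ continuous_const
    exact (continuous_circleMap 0 s).zpow₀ _ fun θ => .inl (hne θ)
  · intro m
    refine .of_forall fun θ _ => ?_
    rw [norm_smul, norm_zpow, hnorm, zpow_sub₀ hs0.ne', zpow_natCast, zpow_natCast, div_pow]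
    calc s ^ n / s ^ m * ‖Φ (a ^ m)‖ ≤ s ^ n / s ^ m * (‖Φ‖ * (K * ‖a‖ ^ m)) := by
          gcongr
          exact (Φ.le_opNorm _).trans (by gcongr; exact hpow m)
      _ = _ := by ring
  · refine .of_forall fun θ _ => Summable.mul_left _ (summable_geometric_of_lt_one (by positivity) ?_)
    rwa [div_lt_one hs0]
  · exact intervalIntegrable_const
  · refine .of_forall fun θ _ => ?_
    have h := ((hasSum_resolvent a (z := circleMap 0 s θ) (by rwa [hnorm])).mapL Φ).const_smul
      (circleMap 0 s θ ^ (n + 1))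
    rw [smul_smul, ← pow_succ']
    convert h using 2 with m
    rw [map_smul, smul_smul, zpow_sub₀ (hne θ), zpow_natCast, zpow_natCast]
    congr 1
    have := hne θ
    rw [inv_pow]
    field_simp
    ring

theorem analyticAt_resolvent {a : 𝒜} {z : ℂ} (hz : z ∈ resolventSet ℂ a) :
    AnalyticAt ℂ (resolvent a) z := by
  refine DifferentiableOn.analyticAt (s := resolventSet ℂ a) (fun w hw => ?_)
    ((spectrum.isOpen_resolventSet a).mem_nhds hz)
  exact (spectrum.hasDerivAt_resolvent_const_left hw).differentiableAt.differentiableWithinAt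

end Banach

/-! ### Pseudospectra of meromorphic functions and the coefficient estimate. -/

section Pseudospectrum

variable {V : Type*} [NormedAddCommGroup V] [NormedSpace ℂ V]

/-- Values at isolated points are irrelevant, so a meromorphic function may be replaced by its
normal form. -/
theorem pseudospectrum_congr {R R' : ℂ → V →L[ℂ] V} (h : ∀ z, R =ᶠ[𝓝[≠] z] R') (ε : ℝ) :
    pseudospectrum R ε = pseudospectrum R' ε := by
  have : ∀ z, resolventNorm R z = resolventNorm R' z := fun z =>
    limsup_congr ((h z).mono fun w hw => by rw [hw])
  simp only [pseudospectrum, this]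

theorem resolventNorm_eq_top {R : ℂ → V →L[ℂ] V} {z : ℂ}
    (h : Tendsto R (𝓝[≠] z) (Bornology.cobounded _)) : resolventNorm R z = ∞ := by
  refine Tendsto.limsup_eq ?_
  have h1 : Tendsto (fun w => ‖R w‖) (𝓝[≠] z) atTop := tendsto_norm_cobounded_atTop.comp h
  have h2 := ENNReal.tendsto_ofReal_atTop.comp h1
  exact h2.congr fun w => ofReal_norm (R w)

theorem mem_pseudospectrum_iff {R : ℂ → V →L[ℂ] V} {z : ℂ} (h : ContinuousAt R z) (ε : ℝ) :
    z ∈ pseudospectrum R ε ↔ ENNReal.ofReal ε⁻¹ < ‖R z‖ₑ := by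
  rw [← resolventNorm_eq R z h]; rfl

theorem not_analyticAt_tendsto_cobounded {R : ℂ → V →L[ℂ] V} {z : ℂ} (hR : MeromorphicNFAt R z)
    (h : ¬ AnalyticAt ℂ R z) : Tendsto R (𝓝[≠] z) (Bornology.cobounded _) := by
  rw [tendsto_cobounded_iff_meromorphicOrderAt_neg hR.meromorphicAt, ← not_le,
    hR.meromorphicOrderAt_nonneg_iff_analyticAt]
  exact h

theorem mem_pseudospectrum_of_not_analyticAt {R : ℂ → V →L[ℂ] V} {z : ℂ}
    (hR : MeromorphicNFAt R z) (h : ¬ AnalyticAt ℂ R z) (ε : ℝ) : z ∈ pseudospectrum R ε := by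
  change ENNReal.ofReal ε⁻¹ < resolventNorm R z
  rw [resolventNorm_eq_top (not_analyticAt_tendsto_cobounded hR h)]
  exact ENNReal.ofReal_lt_top

/-- Continuity of the norm handles points of analyticity. In normal form any other point is a pole,
and the norm exceeds `ε⁻¹` on a punctured neighbourhood of it. -/
theorem isOpen_pseudospectrum_of_meromorphicNFAt [CompleteSpace V] {R : ℂ → V →L[ℂ] V}
    (hR : ∀ z, MeromorphicNFAt R z) (ε : ℝ) : IsOpen (pseudospectrum R ε) := by
  refine isOpen_iff_mem_nhds.2 fun z hz => ?_
  by_cases h : AnalyticAt ℂ R z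
  · rw [mem_pseudospectrum_iff h.continuousAt] at hz
    filter_upwards [h.eventually_analyticAt,
      (h.continuousAt.enorm).eventually (lt_mem_nhds hz)] with w hw1 hw2
    rwa [mem_pseudospectrum_iff hw1.continuousAt]
  · have h1 : ∀ᶠ w in 𝓝[≠] z, ENNReal.ofReal ε⁻¹ < ‖R w‖ₑ := by
      have h2 := tendsto_norm_cobounded_atTop.comp (not_analyticAt_tendsto_cobounded (hR z) h)
      filter_upwards [h2.eventually_gt_atTop ε⁻¹, h2.eventually_gt_atTop 0] with w hw hw0
      rw [← ofReal_norm]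
      exact (ENNReal.ofReal_lt_ofReal_iff hw0).2 hw
    have h3 : ∀ᶠ w in 𝓝[≠] z, w ∈ pseudospectrum R ε := by
      filter_upwards [h1, (hR z).meromorphicAt.eventually_analyticAt] with w hw1 hw2
      rwa [mem_pseudospectrum_iff hw2.continuousAt]
    rw [eventually_nhdsWithin_iff] at h3
    filter_upwards [h3] with w hw
    by_cases hwz : w = z
    · rwa [hwz]
    · exact hw hwz

variable {𝒜 : Type*} [NormedRing 𝒜] [NormedAlgebra ℂ 𝒜] [CompleteSpace 𝒜]

theorem isBounded_pseudospectrum_resolvent (a : 𝒜) (Φ : 𝒜 →L[ℂ] V →L[ℂ] V) {ε : ℝ} (hε : 0 < ε) :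
    Bornology.IsBounded (pseudospectrum (fun z => Φ (resolvent a z)) ε) := by
  have h1 : Tendsto (fun z => ‖Φ (resolvent a z)‖) (Bornology.cobounded ℂ) (𝓝 0) := by
    have := (Φ.continuous.tendsto 0).comp (spectrum.resolvent_tendsto_cobounded (𝕜 := ℂ) a)
    rw [map_zero] at this
    simpa using this.norm
  have h2 : ∀ᶠ z in Bornology.cobounded ℂ, z ∉ pseudospectrum (fun z => Φ (resolvent a z)) ε := by
    filter_upwards [h1.eventually (gt_mem_nhds (inv_pos.2 hε)),
      tendsto_norm_cobounded_atTop.eventually_gt_atTop (‖a‖ * ‖(1 : 𝒜)‖)] with z hz1 hz2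
    have hc : ContinuousAt (fun z => Φ (resolvent a z)) z :=
      Φ.continuous.continuousAt.comp
        (analyticAt_resolvent (spectrum.mem_resolventSet_of_norm_lt_mul hz2)).continuousAt
    rw [mem_pseudospectrum_iff hc, not_lt, ← ofReal_norm]
    exact ENNReal.ofReal_le_ofReal hz1.le
  exact h2

theorem pseudospectralRadius_lt_top {R : ℂ → V →L[ℂ] V} {ε : ℝ}
    (hb : Bornology.IsBounded (pseudospectrum R ε)) : pseudospectralRadius R ε < ∞ := by
  obtain ⟨C, hC⟩ := hb.exists_norm_le
  refine lt_of_le_of_lt (iSup₂_le (a := ENNReal.ofReal C) fun z hz => ?_) ENNReal.ofReal_lt_top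
  rw [← ofReal_norm]
  exact ENNReal.ofReal_le_ofReal (hC z hz)

theorem norm_le_pseudospectralRadius {R : ℂ → V →L[ℂ] V} {ε : ℝ}
    (hb : Bornology.IsBounded (pseudospectrum R ε)) {z : ℂ}
    (hz : z ∈ closure (pseudospectrum R ε)) : ‖z‖ ≤ (pseudospectralRadius R ε).toReal := by
  have hcl : IsClosed {z : ℂ | ‖z‖ ≤ (pseudospectralRadius R ε).toReal} :=
    isClosed_le continuous_norm continuous_const
  refine closure_minimal (fun w hw => ?_) hcl hz
  rw [Set.mem_ofPred_eq, ← ENNReal.ofReal_le_iff_le_toReal (pseudospectralRadius_lt_top hb).ne,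
    ofReal_norm]
  exact le_iSup₂ (f := fun w (_ : w ∈ pseudospectrum R ε) => ‖w‖ₑ) w hw

/-- The estimate of the coefficient `Φ (a ^ n)` in the Laurent series of `Φ ((z - a)⁻¹)` at
infinity by the length of the boundary of the pseudospectrum and by the pseudospectral radius. -/
theorem enorm_apply_pow_le [CompleteSpace V] {a : 𝒜} {q : Polynomial ℂ} (hq : q ≠ 0) (hqa : Polynomial.aeval a q = 0)
    (Φ : 𝒜 →L[ℂ] V →L[ℂ] V) {ε : ℝ} (hε : 0 < ε) (n : ℕ) :
    ‖Φ (a ^ n)‖ₑ ≤ boundaryLength (fun z => Φ (resolvent a z)) ε *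
      pseudospectralRadius (fun z => Φ (resolvent a z)) ε ^ n / ENNReal.ofReal (2 * Real.pi * ε) := by
  set R : ℂ → V →L[ℂ] V := fun z => Φ (resolvent a z) with hR
  have hmer : ∀ z, MeromorphicAt R z := meromorphicAt_apply_resolvent hq hqa Φ
  set U := pseudospectrum R ε with hUdef
  -- `resolvent` takes a default value on the spectrum. The normal form removes the removable
  -- singularities, so that `S` is analytic everywhere off `U`.
  set S := toMeromorphicNFOn R Set.univ with hS
  have hNF : ∀ z, MeromorphicNFAt S z := fun z =>
    meromorphicNFOn_toMeromorphicNFOn R Set.univ (Set.mem_univ z)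
  have hUS : U = pseudospectrum S ε := pseudospectrum_congr (fun z =>
    (MeromorphicOn.toMeromorphicNFOn_eq_self_on_nhdsNE (fun z _ => hmer z)
      (Set.mem_univ z)).symm) ε
  have hSR : ∀ z, AnalyticAt ℂ R z → S =ᶠ[𝓝 z] R := fun z hz => by
    have := toMeromorphicNFOn_eq_toMeromorphicNFAt_on_nhds (fun z _ => hmer z) (Set.mem_univ z)
    rwa [toMeromorphicNFAt_eq_self.2 hz.meromorphicNFAt] at this
  have hUo : IsOpen U := hUS ▸ isOpen_pseudospectrum_of_meromorphicNFAt hNF ε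
  have hUb : Bornology.IsBounded U := isBounded_pseudospectrum_resolvent a Φ hε
  have hρt := pseudospectralRadius_lt_top hUb
  have hSan : ∀ z ∉ U, AnalyticAt ℂ S z := fun z hz => by
    by_contra h
    exact hz (hUS ▸ mem_pseudospectrum_of_not_analyticAt (hNF z) h ε)
  -- The first summand places `z` in the resolvent set without assuming `‖1‖ = 1`; the second makes
  -- the Neumann series converge.
  set r₀ := ‖a‖ * ‖(1 : 𝒜)‖ + ‖a‖ with hr₀
  have hRan : ∀ z : ℂ, r₀ < ‖z‖ → AnalyticAt ℂ R z := fun z hz => by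
    have : ‖a‖ * ‖(1 : 𝒜)‖ < ‖z‖ := by linarith [norm_nonneg a]
    exact (Φ.analyticAt _).comp (analyticAt_resolvent (spectrum.mem_resolventSet_of_norm_lt_mul this))
  have hpos : 0 < 2 * Real.pi * ε := by positivity
  set ρ := pseudospectralRadius R ε with hρ
  -- An infinite length could only be harmful through `∞ * 0`. But `ρ = 0` forces the open set `U`
  -- into `{0}`, hence `U = ∅`, whose boundary has length zero.
  rcases eq_or_ne (boundaryLength R ε) ∞ with hLt | hLt
  · have hρ0 : ρ ≠ 0 := by
      intro h0
      have hsub : U ⊆ {0} := fun z hz => by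
        have := norm_le_pseudospectralRadius hUb (subset_closure hz)
        rw [← hρ, h0, ENNReal.toReal_zero] at this
        simpa using this
      have : U = ∅ := by
        refine (Set.subset_singleton_iff_eq.1 hsub).resolve_right fun h => ?_
        exact not_isOpen_singleton (0 : ℂ) (h ▸ hUo)
      rw [boundaryLength, ← hUdef, this] at hLt
      simp at hLt
    rw [hLt, ENNReal.top_mul (pow_ne_zero _ hρ0), ENNReal.top_div_of_ne_top ENNReal.ofReal_ne_top]
    exact le_top
  have hLt' : Measure.hausdorffMeasure 1 (frontier U) < (∞ : ℝ≥0∞) := lt_top_iff_ne_top.2 hLt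
  have hmain := enorm_le_of_frontier hUo hUb hLt' (f := fun z => z ^ n • S z)
    (C := ρ.toReal ^ n * ε⁻¹) (r₀ := r₀) (c := Φ (a ^ n))
    (fun z hz => (analyticAt_id.pow n).smul (hSan z hz)) ?_ (by positivity) ?_ ?_
  · rw [ENNReal.le_div_iff_mul_le (.inl (by simpa using hpos)) (.inl ENNReal.ofReal_ne_top)]
    have h2 : ENNReal.ofReal (ρ.toReal ^ n * ε⁻¹) = ρ ^ n * ENNReal.ofReal ε⁻¹ := by
      rw [ENNReal.ofReal_mul (by positivity), ENNReal.ofReal_pow ENNReal.toReal_nonneg,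
        ENNReal.ofReal_toReal hρt.ne]
    rw [enorm_smul, Real.enorm_of_nonneg (by positivity), h2] at hmain
    calc ‖Φ (a ^ n)‖ₑ * ENNReal.ofReal (2 * Real.pi * ε)
        = (ENNReal.ofReal (2 * Real.pi) * ‖Φ (a ^ n)‖ₑ) * ENNReal.ofReal ε := by
          rw [ENNReal.ofReal_mul (p := 2 * Real.pi) (by positivity)]; ring
      _ ≤ (ρ ^ n * ENNReal.ofReal ε⁻¹ * Measure.hausdorffMeasure 1 (frontier U))
            * ENNReal.ofReal ε := by gcongr
      _ = boundaryLength R ε * ρ ^ n * (ENNReal.ofReal ε⁻¹ * ENNReal.ofReal ε) := by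
          rw [boundaryLength]; ring
      _ = _ := by
          rw [← ENNReal.ofReal_mul (by positivity), inv_mul_cancel₀ hε.ne', ENNReal.ofReal_one,
            mul_one]
  · intro z hz
    have hzU : z ∉ U := fun h => by
      rw [hUo.frontier_eq] at hz; exact hz.2 h
    have hSz := (hSan z hzU).continuousAt
    have h1 : ‖S z‖ ≤ ε⁻¹ := by
      rw [hUS, mem_pseudospectrum_iff hSz, not_lt, ← ofReal_norm,
        ENNReal.ofReal_le_ofReal_iff (by positivity)] at hzU
      exact hzU
    rw [norm_smul, norm_pow]
    gcongr
    exact norm_le_pseudospectralRadius hUb (frontier_subset_closure hz)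
  · intro z hz
    exact (analyticAt_id.pow n).smul ((hRan z hz).congr (hSR z (hRan z hz)).symm)
  · intro s hs
    rw [← integral_circleMap_resolvent a Φ n (s := s)
      (lt_of_le_of_lt (le_add_of_nonneg_left (by positivity)) hs)]
    refine intervalIntegral.integral_congr fun θ _ => ?_
    rw [(hSR _ (hRan _ ?_)).eq_of_nhds]
    rw [norm_circleMap_zero]
    exact hs.trans_le (le_abs_self s)

end Pseudospectrum

/-! ### Length of sets that are locally Lipschitz graphs. -/

/-- The hypothesis makes `π` injective on `T` with a `K`-Lipschitz inverse, and `T` is the image of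
`π '' T` under this inverse. -/
theorem hausdorffMeasure_le_volume_image {T : Set ℂ} {π : ℂ → ℝ} {K : NNReal}
    (h : ∀ u ∈ T, ∀ v ∈ T, dist u v ≤ K * dist (π u) (π v)) :
    Measure.hausdorffMeasure 1 T ≤ K * volume (π '' T) := by
  rcases T.eq_empty_or_nonempty with rfl | hne
  · simp
  have : Nonempty ℂ := ⟨0⟩
  have hinj : Set.InjOn π T := fun u hu v hv huv => by
    have := h u hu v hv
    rw [huv, dist_self, mul_zero] at this
    exact dist_le_zero.1 this
  set g := Function.invFunOn π T
  have hg : ∀ u ∈ T, g (π u) = u := fun u hu => hinj.leftInvOn_invFunOn hu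
  have hL : LipschitzOnWith K g (π '' T) := by
    refine LipschitzOnWith.of_dist_le_mul ?_
    rintro _ ⟨u, hu, rfl⟩ _ ⟨v, hv, rfl⟩
    rw [hg u hu, hg v hv]
    exact h u hu v hv
  have h1 := hL.hausdorffMeasure_image_le zero_le_one
  have h2 : g '' (π '' T) = T := by
    ext z
    constructor
    · rintro ⟨_, ⟨u, hu, rfl⟩, rfl⟩
      rwa [hg u hu]
    · exact fun hz => ⟨π z, ⟨z, hz, rfl⟩, hg z hz⟩
  rwa [h2, hausdorffMeasure_real, ENNReal.rpow_one] at h1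

/-- A bounded set which is locally a Lipschitz graph and meets the fibres of the projection in at
most `d` points has finite length. -/
theorem hausdorffMeasure_lt_top_of_fibers {T : Set ℂ} (hT : MeasurableSet T) {π : ℂ → ℝ}
    (hπ : Continuous π) (hb : Bornology.IsBounded T) {K : NNReal}
    (hloc : ∀ z ∈ T, ∃ W ∈ 𝓝 z, ∀ u ∈ T ∩ W, ∀ v ∈ T ∩ W, dist u v ≤ K * dist (π u) (π v))
    {d : ℕ} (hd : ∀ x, (T ∩ π ⁻¹' {x}).encard ≤ d) :
    Measure.hausdorffMeasure 1 T < (∞ : ℝ≥0∞) := by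
  have hW : ∀ z, ∃ W, IsOpen W ∧ (z ∈ T → z ∈ W) ∧
      ∀ u ∈ T ∩ W, ∀ v ∈ T ∩ W, dist u v ≤ K * dist (π u) (π v) := fun z => by
    by_cases hz : z ∈ T
    · obtain ⟨W, hW, h⟩ := hloc z hz
      refine ⟨interior W, isOpen_interior, fun _ => mem_interior_iff_mem_nhds.2 hW, ?_⟩
      exact fun u hu v hv => h u ⟨hu.1, interior_subset hu.2⟩ v ⟨hv.1, interior_subset hv.2⟩
    · exact ⟨∅, isOpen_empty, fun h => absurd h hz, by simp⟩
  choose W hWo hzW hWd using hW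
  rcases T.eq_empty_or_nonempty with rfl | hne
  · simp
  obtain ⟨s, hsT, hsc, hs⟩ := TopologicalSpace.countable_cover_nhdsWithin (s := T) (f := W)
    fun z hz => nhdsWithin_le_nhds ((hWo z).mem_nhds (hzW z hz))
  have hsne : s.Nonempty := by
    by_contra h
    rw [Set.not_nonempty_iff_eq_empty] at h
    subst h
    simp at hs
    exact hne.ne_empty hs
  obtain ⟨e, rfl⟩ := hsc.exists_eq_range hsne
  rw [Set.biUnion_range] at hs
  set D : ℕ → Set ℂ := fun i => T ∩ disjointed (fun i => W (e i)) i with hD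
  have hDm : ∀ i, MeasurableSet (D i) := fun i =>
    hT.inter (MeasurableSet.disjointed (fun i => (hWo (e i)).measurableSet) i)
  have hDW : ∀ i, D i ⊆ T ∩ W (e i) := fun i =>
    Set.inter_subset_inter_right _ (disjointed_subset _ i)
  have hDd : Pairwise (Function.onFun Disjoint D) := fun i j hij =>
    (disjoint_disjointed _ hij).mono Set.inter_subset_right Set.inter_subset_right
  have hTD : T = ⋃ i, D i := by
    rw [hD, ← Set.inter_iUnion, iUnion_disjointed]
    exact (Set.inter_eq_left.2 hs).symm
  have hinj : ∀ i, Set.InjOn π (D i) := fun i u hu v hv huv => by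
    have := hWd (e i) u (hDW i hu) v (hDW i hv)
    rw [huv, dist_self, mul_zero] at this
    exact dist_le_zero.1 this
  have him : ∀ i, MeasurableSet (π '' D i) := fun i =>
    (hDm i).image_of_continuousOn_injOn hπ.continuousOn (hinj i)
  obtain ⟨J, hJ⟩ : ∃ J, π '' T ⊆ Set.Icc (-J) J := by
    obtain ⟨J, hJ⟩ := ((hb.isCompact_closure.image hπ).isBounded).exists_norm_le
    exact ⟨J, fun x hx => abs_le.1 (hJ x (Set.image_mono subset_closure hx))⟩
  -- The pieces `D i` are disjoint, so those whose projection contains `x` yield distinct points of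
  -- one fibre. Integrating this count over `x` bounds the sum of the projected lengths.
  have hcount : ∀ x, ∑' i, (π '' D i).indicator (fun _ => (1 : ℝ≥0∞)) x ≤
      (Set.Icc (-J) J).indicator (fun _ => (d : ℝ≥0∞)) x := by
    intro x
    rw [ENNReal.tsum_eq_iSup_sum]
    refine iSup_le fun F => ?_
    classical
    have hsum : ∑ i ∈ F, (π '' D i).indicator (fun _ => (1 : ℝ≥0∞)) x =
        ((F.filter fun i => x ∈ π '' D i).card : ℝ≥0∞) := by
      simp [Set.indicator_apply]
    rw [hsum]
    by_cases hx : x ∈ Set.Icc (-J) J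
    · rw [Set.indicator_of_mem hx]
      have hch : ∀ i : {i // i ∈ F.filter fun i => x ∈ π '' D i}, ∃ z, z ∈ D i ∧ π z = x :=
        fun i => (Finset.mem_filter.1 i.2).2
      choose z hz hzx using hch
      have hzinj : Function.Injective z := fun i j hij => by
        by_contra hne
        have := hDd (fun h => hne (Subtype.ext h))
        exact Set.disjoint_left.1 this (hz i) (hij ▸ hz j)
      have hsub : Set.range z ⊆ T ∩ π ⁻¹' {x} := by
        rintro _ ⟨i, rfl⟩
        exact ⟨(hz i).1, hzx i⟩
      have h1 := (Set.encard_le_encard hsub).trans (hd x)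
      rw [← Set.image_univ, hzinj.encard_image, Set.encard_univ, ENat.card_eq_coe_fintype_card,
        Fintype.card_coe] at h1
      exact_mod_cast h1
    · rw [Set.indicator_of_notMem hx]
      have : (F.filter fun i => x ∈ π '' D i) = ∅ :=
        Finset.filter_eq_empty_iff.2 fun i _ hi => hx (hJ (Set.image_mono Set.inter_subset_left hi))
      rw [this, Finset.card_empty, Nat.cast_zero]
  calc Measure.hausdorffMeasure 1 T ≤ ∑' i, Measure.hausdorffMeasure 1 (D i) := by
        conv_lhs => rw [hTD]
        exact measure_iUnion_le _
    _ ≤ ∑' i, K * volume (π '' D i) := ENNReal.tsum_le_tsum fun i =>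
        hausdorffMeasure_le_volume_image fun u hu v hv => hWd (e i) u (hDW i hu) v (hDW i hv)
    _ = K * ∑' i, ∫⁻ x, (π '' D i).indicator (fun _ => (1 : ℝ≥0∞)) x := by
        rw [ENNReal.tsum_mul_left]
        congr 2 with i
        rw [lintegral_indicator (him i), setLIntegral_one]
    _ = K * ∫⁻ x, ∑' i, (π '' D i).indicator (fun _ => (1 : ℝ≥0∞)) x := by
        rw [lintegral_tsum fun i => (measurable_const.indicator (him i)).aemeasurable]
    _ ≤ K * ∫⁻ x, (Set.Icc (-J) J).indicator (fun _ => (d : ℝ≥0∞)) x := by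
        gcongr with x
        exact hcount x
    _ < ∞ := by
        rw [lintegral_indicator measurableSet_Icc, setLIntegral_const, Real.volume_Icc]
        finiteness

/-- The part of the zero set of `f` where the derivative in the vertical direction dominates. -/
def steepZeros (f : ℂ → ℂ) (r : ℝ) : Set ℂ :=
  {z | ‖z‖ ≤ r ∧ f z = 0 ∧ ‖fderiv ℝ f z 1‖ ≤ ‖fderiv ℝ f z Complex.I‖ ∧
    fderiv ℝ f z Complex.I ≠ 0}

theorem hausdorffMeasure_steepZeros_lt_top {f : ℂ → ℂ} (hf : ContDiff ℝ 1 f) (r : ℝ) {d : ℕ}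
    (hd : ∀ x : ℝ, (steepZeros f r ∩ Complex.re ⁻¹' {x}).encard ≤ d) :
    Measure.hausdorffMeasure 1 (steepZeros f r) < (∞ : ℝ≥0∞) := by
  have hc : ∀ v, Continuous fun z => fderiv ℝ f z v := fun v =>
    (hf.continuous_fderiv one_ne_zero).clm_apply continuous_const
  have hcf := hf.continuous
  have hm : MeasurableSet (steepZeros f r) := by
    refine (isClosed_le continuous_norm continuous_const).measurableSet.inter ?_
    refine (isClosed_eq hcf continuous_const).measurableSet.inter ?_
    refine (isClosed_le (hc 1).norm (hc Complex.I).norm).measurableSet.inter ?_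
    exact (isOpen_ne_fun (hc Complex.I) continuous_const).measurableSet
  have hb : Bornology.IsBounded (steepZeros f r) :=
    Metric.isBounded_closedBall.subset fun z hz => mem_closedBall_zero_iff.2 hz.1
  -- For nearby zeros with difference `x + iy`, linearization with error `‖b‖ / 4` gives `|y| ≤ (|x|
  -- + |y|) / 4 + |x|`, hence `|y| ≤ 5/3 |x|` and `|x| + |y| ≤ 3 |x|`.
  refine hausdorffMeasure_lt_top_of_fibers hm Complex.continuous_re hb (K := 3) ?_ hd
  rintro z ⟨-, -, hab, hb0⟩
  set a := fderiv ℝ f z 1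
  set b := fderiv ℝ f z Complex.I
  have hbpos : 0 < ‖b‖ := norm_pos_iff.2 hb0
  have hs := (hf.contDiffAt (x := z)).hasStrictFDerivAt one_ne_zero
  have h1 := hs.isLittleO.def (c := ‖b‖ / 4) (by positivity)
  rw [nhds_prod_eq] at h1
  obtain ⟨W, hW, hWs⟩ := (Filter.eventually_prod_self_iff (r := fun u v : ℂ =>
    ‖f u - f v - fderiv ℝ f z (u - v)‖ ≤ ‖b‖ / 4 * ‖u - v‖)).1 h1
  refine ⟨W, hW, fun u hu v hv => ?_⟩
  have h2 := hWs u hu.2 v hv.2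
  rw [hu.1.2.1, hv.1.2.1, sub_zero, zero_sub, norm_neg] at h2
  set x := (u - v).re with hx
  set y := (u - v).im with hy
  have h3 : fderiv ℝ f z (u - v) = x * a + y * b := by
    have : u - v = x • (1 : ℂ) + y • Complex.I := by
      rw [Complex.real_smul, Complex.real_smul, mul_one]; exact (Complex.re_add_im _).symm
    rw [this, map_add, map_smul, map_smul, Complex.real_smul, Complex.real_smul]
  have h4 : ‖u - v‖ ≤ |x| + |y| := Complex.norm_le_abs_re_add_abs_im _
  have h5 : |y| * ‖b‖ ≤ ‖(x : ℂ) * a + y * b‖ + |x| * ‖a‖ := by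
    have := norm_sub_le ((x : ℂ) * a + y * b) (x * a)
    rwa [add_sub_cancel_left, norm_mul, norm_mul, Complex.norm_real, Complex.norm_real,
      Real.norm_eq_abs, Real.norm_eq_abs] at this
  rw [h3] at h2
  have h6 : |x| * ‖a‖ ≤ |x| * ‖b‖ := by gcongr
  have h7 : ‖b‖ * |y| ≤ ‖b‖ * ((|x| + |y|) / 4 + |x|) := by
    have : ‖b‖ / 4 * ‖u - v‖ ≤ ‖b‖ / 4 * (|x| + |y|) := by gcongr
    linarith
  have h8 := le_of_mul_le_mul_left h7 hbpos
  rw [dist_eq_norm, Real.dist_eq, ← Complex.sub_re, ← hx]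
  push_cast
  linarith [abs_nonneg x]

/-! ### Real algebraic curves have locally finite length. -/

/-- The function of the real and the imaginary part given by a polynomial in two variables. -/
noncomputable def evalReIm (p : Polynomial (Polynomial ℂ)) (z : ℂ) : ℂ :=
  p.evalEval (z.re : ℂ) (z.im : ℂ)

theorem evalReIm_eq_eval (p : Polynomial (Polynomial ℂ)) (z : ℂ) :
    evalReIm p z = (p.map (Polynomial.evalRingHom (z.re : ℂ))).eval (z.im : ℂ) :=
  (Polynomial.map_evalRingHom_eval _ _ _).symm

theorem contDiff_evalReIm (p : Polynomial (Polynomial ℂ)) : ContDiff ℝ 1 (evalReIm p) := by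
  have hre : ContDiff ℝ 1 fun z : ℂ => (z.re : ℂ) :=
    Complex.ofRealCLM.contDiff.comp Complex.reCLM.contDiff
  have him : ContDiff ℝ 1 fun z : ℂ => (z.im : ℂ) :=
    Complex.ofRealCLM.contDiff.comp Complex.imCLM.contDiff
  have h1 : ∀ q : Polynomial ℂ, ContDiff ℝ 1 fun z : ℂ => q.eval (z.re : ℂ) := fun q => by
    simp only [Polynomial.eval_eq_sum_range]
    exact ContDiff.sum fun i _ => contDiff_const.mul (hre.pow i)
  unfold evalReIm
  induction p using Polynomial.induction_on' with
  | add p q hp hq => simpa only [Polynomial.evalEval_add] using hp.add hq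
  | monomial n q =>
    simp only [← Polynomial.C_mul_X_pow_eq_monomial, Polynomial.evalEval_mul,
      Polynomial.evalEval_C, Polynomial.evalEval_pow, Polynomial.evalEval_X]
    exact (h1 q).mul (him.pow n)

theorem fderiv_evalReIm_I (p : Polynomial (Polynomial ℂ)) (z : ℂ) :
    fderiv ℝ (evalReIm p) z Complex.I = evalReIm (Polynomial.derivative p) z := by
  have h1 := ((contDiff_evalReIm p).differentiable one_ne_zero z).hasFDerivAt.hasLineDerivAt
    Complex.I
  have h2 : HasDerivAt (fun t : ℝ => evalReIm p (z + t • Complex.I))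
      (evalReIm (Polynomial.derivative p) z) 0 := by
    have h3 : ∀ t : ℝ, evalReIm p (z + t • Complex.I) =
        (p.map (Polynomial.evalRingHom (z.re : ℂ))).eval ((z.im : ℂ) + t) := fun t => by
      rw [evalReIm_eq_eval]; simp
    simp only [h3]
    rw [evalReIm_eq_eval, ← Polynomial.derivative_map]
    have h4 : HasDerivAt (fun t : ℝ => (z.im : ℂ) + t) 1 0 :=
      Complex.ofRealCLM.hasDerivAt.const_add _
    have h5 := (p.map (Polynomial.evalRingHom (z.re : ℂ))).hasDerivAt ((z.im : ℂ) + (0 : ℝ))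
    have h6 := h5.comp (0 : ℝ) h4
    exact h6.congr_deriv (by simp)
  exact HasDerivAt.unique h1 h2

/-- The reflection that exchanges the real and the imaginary part. -/
noncomputable def reflect : ℂ ≃ₗᵢ[ℝ] ℂ :=
  Complex.conjLIE.trans (rotation ⟨Complex.I, by simp [Submonoid.unitSphere]⟩)

theorem reflect_apply (z : ℂ) : reflect z = Complex.I * (starRingEnd ℂ) z := rfl

theorem evalReIm_swap (p : Polynomial (Polynomial ℂ)) (z : ℂ) :
    evalReIm (Polynomial.Bivariate.swap p) z = evalReIm p (reflect z) := by
  rw [evalReIm, evalReIm, ← Polynomial.coe_aevalAeval_eq_evalEval,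
    ← Polynomial.coe_aevalAeval_eq_evalEval, Polynomial.Bivariate.aevalAeval_swap]
  simp [reflect_apply]

theorem fderiv_evalReIm_swap (p : Polynomial (Polynomial ℂ)) (z v : ℂ) :
    fderiv ℝ (evalReIm (Polynomial.Bivariate.swap p)) z v =
      fderiv ℝ (evalReIm p) (reflect z) (reflect v) := by
  have h1 : evalReIm (Polynomial.Bivariate.swap p) = evalReIm p ∘ reflect :=
    funext fun z => evalReIm_swap p z
  have h2 := ((contDiff_evalReIm p).differentiable one_ne_zero (reflect z)).hasFDerivAt.comp z
    (reflect.toContinuousLinearEquiv.hasFDerivAt (x := z))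
  have h3 : HasFDerivAt (evalReIm p ∘ reflect) _ z := h2
  rw [h1, h3.fderiv]
  rfl

/-- On a vertical line the zeros are roots of a polynomial in one variable. It is not the zero
polynomial if the line contains a steep zero, because its derivative is nonzero there; so its degree
bounds the fibres. -/
theorem hausdorffMeasure_steepZeros_evalReIm_lt_top (p : Polynomial (Polynomial ℂ)) (r : ℝ) :
    Measure.hausdorffMeasure 1 (steepZeros (evalReIm p) r) < (∞ : ℝ≥0∞) := by
  refine hausdorffMeasure_steepZeros_lt_top (contDiff_evalReIm p) r (d := p.natDegree) fun x => ?_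
  set q := p.map (Polynomial.evalRingHom (x : ℂ)) with hq
  have hinj : Set.InjOn (fun z : ℂ => (z.im : ℂ)) (steepZeros (evalReIm p) r ∩ Complex.re ⁻¹' {x}) :=
    fun u hu v hv huv => Complex.ext (hu.2.trans hv.2.symm) (Complex.ofReal_injective huv)
  rcases (steepZeros (evalReIm p) r ∩ Complex.re ⁻¹' {x}).eq_empty_or_nonempty with he | ⟨w, hw⟩
  · simp [he]
  have hq0 : q ≠ 0 := fun h0 => by
    have hwx : w.re = x := hw.2
    apply hw.1.2.2.2
    rw [fderiv_evalReIm_I, evalReIm_eq_eval, hwx, ← Polynomial.derivative_map, ← hq, h0]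
    simp
  classical
  have hsub : (fun z : ℂ => (z.im : ℂ)) '' (steepZeros (evalReIm p) r ∩ Complex.re ⁻¹' {x}) ⊆
      (q.roots.toFinset : Set ℂ) := by
    rintro _ ⟨z, hz, rfl⟩
    have hzx : z.re = x := hz.2
    have := hz.1.2.1
    rw [evalReIm_eq_eval, hzx] at this
    simpa [hq0, Polynomial.IsRoot] using this
  rw [← hinj.encard_image]
  refine (Set.encard_le_encard hsub).trans ?_
  rw [Set.encard_coe_eq_coe_finsetCard]
  exact_mod_cast (Multiset.toFinset_card_le _).trans
    ((Polynomial.card_roots' q).trans Polynomial.natDegree_map_le)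

theorem hausdorffMeasure_vertical_lt_top (x r : ℝ) :
    Measure.hausdorffMeasure 1 {z : ℂ | ‖z‖ ≤ r ∧ z.re = x} < (∞ : ℝ≥0∞) := by
  refine (hausdorffMeasure_le_volume_image (π := Complex.im) (K := 1) ?_).trans_lt ?_
  · rintro u ⟨-, hu⟩ v ⟨-, hv⟩
    rw [NNReal.coe_one, one_mul, Complex.dist_of_re_eq (hu.trans hv.symm)]
  · have : Complex.im '' {z : ℂ | ‖z‖ ≤ r ∧ z.re = x} ⊆ Set.Icc (-r) r := by
      rintro _ ⟨z, ⟨hz, -⟩, rfl⟩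
      exact abs_le.1 ((Complex.abs_im_le_norm z).trans hz)
    have h1 := (measure_mono (μ := volume) this).trans_lt measure_Icc_lt_top
    finiteness

/-- A bounded piece of an algebraic curve has finite length. -/
theorem hausdorffMeasure_zeros_lt_top {p : Polynomial (Polynomial ℂ)} (hp : p ≠ 0) (r : ℝ) :
    Measure.hausdorffMeasure 1 {z : ℂ | ‖z‖ ≤ r ∧ evalReIm p z = 0} < (∞ : ℝ≥0∞) := by
  -- The induction is on the degree in the imaginary part. If the derivative in that variable is the
  -- zero polynomial, the curve consists of vertical lines over finitely many real parts.
  induction hn : p.natDegree using Nat.strong_induction_on generalizing p with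
  | _ n ih =>
  by_cases hd : Polynomial.derivative p = 0
  · obtain ⟨q, rfl⟩ := Polynomial.natDegree_eq_zero.1
      (Polynomial.derivative_eq_zero.1 hd)
    have hq : q ≠ 0 := fun h => hp (by rw [h, map_zero])
    have hfin : {x : ℝ | q.eval (x : ℂ) = 0}.Finite := by
      have h1 : {w : ℂ | q.eval w = 0}.Finite := by
        simpa [Polynomial.IsRoot] using Polynomial.finite_setOfPred_isRoot hq
      exact h1.preimage Complex.ofReal_injective.injOn
    refine (measure_mono (t := ⋃ x ∈ {x : ℝ | q.eval (x : ℂ) = 0},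
      {z : ℂ | ‖z‖ ≤ r ∧ z.re = x}) ?_).trans_lt
      (measure_biUnion_lt_top hfin fun x _ => hausdorffMeasure_vertical_lt_top x r)
    rintro z ⟨hz, hz0⟩
    rw [evalReIm, Polynomial.evalEval_C] at hz0
    exact Set.mem_biUnion (x := z.re) hz0 ⟨hz, rfl⟩
  · have hlt : (Polynomial.derivative p).natDegree < n := by
      rw [← hn]
      refine Polynomial.natDegree_derivative_lt fun h0 => hd ?_
      exact Polynomial.derivative_of_natDegree_zero h0
    have h1 := ih _ hlt hd rfl
    have h2 := hausdorffMeasure_steepZeros_evalReIm_lt_top p r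
    have h3 := hausdorffMeasure_steepZeros_evalReIm_lt_top (Polynomial.Bivariate.swap p) r
    have h4 : (Measure.hausdorffMeasure 1 (reflect ⁻¹'
        steepZeros (evalReIm (Polynomial.Bivariate.swap p)) r) : ℝ≥0∞) < ∞ := by
      exact (reflect.toIsometryEquiv.hausdorffMeasure_preimage 1 _).trans_lt h3
    -- Zeros with vanishing vertical derivative lie on a curve of lower degree. Any other zero is
    -- steep, either vertically or after exchanging the axes.
    refine (measure_mono (t := ({z : ℂ | ‖z‖ ≤ r ∧ evalReIm (Polynomial.derivative p) z = 0} ∪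
      steepZeros (evalReIm p) r) ∪ (reflect ⁻¹'
        steepZeros (evalReIm (Polynomial.Bivariate.swap p)) r)) ?_).trans_lt
      (measure_union_lt_top (measure_union_lt_top h1 h2) h4)
    rintro z ⟨hz, hz0⟩
    by_cases hb : evalReIm (Polynomial.derivative p) z = 0
    · exact .inl (.inl ⟨hz, hb⟩)
    have hb' := hb
    rw [← fderiv_evalReIm_I] at hb'
    rcases le_total ‖fderiv ℝ (evalReIm p) z 1‖ ‖fderiv ℝ (evalReIm p) z Complex.I‖ with h | h
    · exact .inl (.inr ⟨hz, hz0, h, hb'⟩)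
    · have hrr : ∀ w, reflect (reflect w) = w := fun w => by
        simp only [reflect_apply, map_mul, Complex.conj_I, Complex.conj_conj]
        linear_combination (-w) * Complex.I_mul_I
      have hr1 : reflect 1 = Complex.I := by simp [reflect_apply]
      have hrI : reflect Complex.I = 1 := by simp [reflect_apply]
      refine .inr ⟨?_, ?_, ?_, ?_⟩
      · rwa [reflect.norm_map]
      · rwa [evalReIm_swap, hrr]
      · rwa [fderiv_evalReIm_swap, fderiv_evalReIm_swap, hrr, hr1, hrI]
      · rw [fderiv_evalReIm_swap, hrr, hrI]
        exact norm_pos_iff.1 ((norm_pos_iff.2 hb').trans_le h)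

/-! ### Closure properties of polynomial functions of the real and imaginary part. -/

/-- `f` is a polynomial function of the real and the imaginary part. -/
def IsPolyReIm (f : ℂ → ℂ) : Prop := ∃ p, ∀ z, evalReIm p z = f z

namespace IsPolyReIm

variable {f g : ℂ → ℂ}

theorem const (c : ℂ) : IsPolyReIm fun _ => c :=
  ⟨Polynomial.C (Polynomial.C c), fun z => by simp [evalReIm]⟩

theorem add (hf : IsPolyReIm f) (hg : IsPolyReIm g) : IsPolyReIm fun z => f z + g z := by
  obtain ⟨p, hp⟩ := hf
  obtain ⟨q, hq⟩ := hg
  exact ⟨p + q, fun z => by simp only [← hp, ← hq]; exact Polynomial.evalEval_add _ _ _ _⟩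

theorem mul (hf : IsPolyReIm f) (hg : IsPolyReIm g) : IsPolyReIm fun z => f z * g z := by
  obtain ⟨p, hp⟩ := hf
  obtain ⟨q, hq⟩ := hg
  exact ⟨p * q, fun z => by simp only [← hp, ← hq]; exact Polynomial.evalEval_mul _ _ _ _⟩

theorem sub (hf : IsPolyReIm f) (hg : IsPolyReIm g) : IsPolyReIm fun z => f z - g z := by
  obtain ⟨p, hp⟩ := hf
  obtain ⟨q, hq⟩ := hg
  exact ⟨p - q, fun z => by simp only [← hp, ← hq]; exact Polynomial.evalEval_sub _ _ _ _⟩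

theorem conj (hf : IsPolyReIm f) : IsPolyReIm fun z => starRingEnd ℂ (f z) := by
  obtain ⟨p, hp⟩ := hf
  refine ⟨p.map (Polynomial.mapRingHom (starRingEnd ℂ)), fun z => ?_⟩
  simp only [← hp]
  rw [evalReIm, evalReIm, ← Polynomial.map_mapRingHom_evalEval, Complex.conj_ofReal,
    Complex.conj_ofReal]

theorem id : IsPolyReIm fun z => z :=
  ⟨Polynomial.C Polynomial.X + Polynomial.C (Polynomial.C Complex.I) * Polynomial.X, fun z => by
    rw [evalReIm, Polynomial.evalEval_add, Polynomial.evalEval_mul, Polynomial.evalEval_X,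
      Polynomial.evalEval_C, Polynomial.evalEval_C, Polynomial.eval_X, Polynomial.eval_C, mul_comm]
    exact Complex.re_add_im z⟩

theorem pow (hf : IsPolyReIm f) (n : ℕ) : IsPolyReIm fun z => f z ^ n := by
  induction n with
  | zero => simpa using const 1
  | succ n ih => simpa only [pow_succ] using ih.mul hf

theorem sum {ι : Type*} (s : Finset ι) {F : ι → ℂ → ℂ} (h : ∀ i ∈ s, IsPolyReIm (F i)) :
    IsPolyReIm fun z => ∑ i ∈ s, F i z := by
  classical
  induction s using Finset.induction_on with
  | empty => simpa using const 0
  | insert a s ha ih =>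
    simp only [Finset.sum_insert ha]
    exact (h a (Finset.mem_insert_self _ _)).add (ih fun i hi => h i (Finset.mem_insert_of_mem hi))

theorem prod {ι : Type*} (s : Finset ι) {F : ι → ℂ → ℂ} (h : ∀ i ∈ s, IsPolyReIm (F i)) :
    IsPolyReIm fun z => ∏ i ∈ s, F i z := by
  classical
  induction s using Finset.induction_on with
  | empty => simpa using const 1
  | insert a s ha ih =>
    simp only [Finset.prod_insert ha]
    exact (h a (Finset.mem_insert_self _ _)).mul (ih fun i hi => h i (Finset.mem_insert_of_mem hi))

theorem det {n : Type*} [Fintype n] [DecidableEq n] {M : ℂ → Matrix n n ℂ}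
    (h : ∀ i j, IsPolyReIm fun z => M z i j) : IsPolyReIm fun z => (M z).det := by
  simp only [Matrix.det_apply']
  exact sum _ fun σ _ => (const _).mul (prod _ fun i _ => h _ _)

theorem eval (q : Polynomial ℂ) : IsPolyReIm fun z => q.eval z := by
  simp only [Polynomial.eval_eq_sum_range]
  exact sum _ fun i _ => (const _).mul (id.pow i)

theorem apply_resolventNumerator {𝒜 : Type*} [Ring 𝒜] [Algebra ℂ 𝒜] (a : 𝒜) (q : Polynomial ℂ)
    (φ : 𝒜 →ₗ[ℂ] ℂ) : IsPolyReIm fun z => φ (resolventNumerator a q z) := by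
  simp only [resolventNumerator, map_sum, map_smul, smul_eq_mul]
  exact sum _ fun m _ => (const _).mul (sum _ fun i _ => (id.pow i).mul (const _))

end IsPolyReIm

/-! ### Finite boundary length for inner product norms. -/

section InnerProduct

variable {V : Type*} [NormedAddCommGroup V] [InnerProductSpace ℂ V] [FiniteDimensional ℂ V]

/-- The Hermitian operator `c² - ε² G* G`. -/
noncomputable def gramDefect (G : V →L[ℂ] V) (c ε : ℝ) : V →ₗ[ℂ] V :=
  ((c : ℂ) ^ 2 • (1 : V →L[ℂ] V) - (ε : ℂ) ^ 2 • (ContinuousLinearMap.adjoint G * G) : V →L[ℂ] V)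

theorem gramDefect_apply (G : V →L[ℂ] V) (c ε : ℝ) (v : V) : gramDefect G c ε v =
    (c : ℂ) ^ 2 • v - (ε : ℂ) ^ 2 • ContinuousLinearMap.adjoint G (G v) := rfl

theorem inner_gramDefect (G : V →L[ℂ] V) (c ε : ℝ) (u v : V) : inner ℂ u (gramDefect G c ε v) =
    (c : ℂ) ^ 2 * inner ℂ u v - (ε : ℂ) ^ 2 * inner ℂ (G u) (G v) := by
  rw [gramDefect_apply, inner_sub_right, inner_smul_right, inner_smul_right,
    ContinuousLinearMap.adjoint_inner_right]

theorem exists_norm_eq_opNorm (G : V →L[ℂ] V) (hG : ‖G‖ ≠ 0) :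
    ∃ v : V, ‖v‖ = 1 ∧ ‖G v‖ = ‖G‖ := by
  have : Nontrivial V := by
    by_contra h
    rw [not_nontrivial_iff_subsingleton] at h
    exact hG (by rw [Subsingleton.elim G 0, norm_zero])
  have hP : ProperSpace V := FiniteDimensional.proper ℂ V
  let _ : NormedSpace ℝ V := NormedSpace.restrictScalars ℝ ℂ V
  obtain ⟨v, hv, hmax⟩ := (isCompact_sphere (0 : V) 1).exists_isMaxOn
    (NormedSpace.sphere_nonempty.2 zero_le_one) G.continuous.norm.continuousOn
  rw [mem_sphere_zero_iff_norm] at hv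
  refine ⟨v, hv, le_antisymm (by simpa [hv] using G.le_opNorm v) ?_⟩
  refine G.opNorm_le_of_unit_norm (norm_nonneg _) fun u hu => ?_
  exact hmax (mem_sphere_zero_iff_norm.2 hu)

/-- A unit vector `v` at which `G` attains its norm is in the kernel: expanding gives `‖c² v - ε² G*
G v‖² ≤ c⁴ - 2 c⁴ + c⁴ = 0`. -/
theorem det_gramDefect_eq_zero {G : V →L[ℂ] V} {c ε : ℝ} (hc : 0 < c) (hε : 0 < ε)
    (h : ‖G‖ = c / ε) : LinearMap.det (gramDefect G c ε) = 0 := by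
  obtain ⟨v, hv, hGv⟩ := exists_norm_eq_opNorm G (by rw [h]; positivity)
  have h1 : gramDefect G c ε v = 0 := by
    rw [gramDefect_apply]
    set w := ContinuousLinearMap.adjoint G (G v) with hw
    have h2 : ‖w‖ ≤ (c / ε) ^ 2 := by
      refine (ContinuousLinearMap.le_opNorm _ _).trans ?_
      rw [LinearIsometryEquiv.norm_map, hGv, h, sq]
    have h3 : inner ℂ v w = ((c / ε : ℝ) : ℂ) ^ 2 := by
      rw [hw, ContinuousLinearMap.adjoint_inner_right, inner_self_eq_norm_sq_to_K, hGv, h]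
      rfl
    have h4 : ‖(c : ℂ) ^ 2 • v - (ε : ℂ) ^ 2 • w‖ ^ 2 ≤ 0 := by
      rw [norm_sub_sq (𝕜 := ℂ), inner_smul_left, inner_smul_right, h3, norm_smul, norm_smul, hv]
      have h5 : (starRingEnd ℂ) ((c : ℂ) ^ 2) * ((ε : ℂ) ^ 2 * ((c / ε : ℝ) : ℂ) ^ 2) =
          ((c ^ 4 : ℝ) : ℂ) := by
        rw [map_pow, Complex.conj_ofReal]
        norm_cast
        field_simp
      have h6 : RCLike.re ((c ^ 4 : ℝ) : ℂ) = c ^ 4 := Complex.ofReal_re _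
      have h7 : ε ^ 2 * ‖w‖ ≤ c ^ 2 := by
        rw [div_pow, le_div_iff₀ (by positivity)] at h2
        linarith
      rw [h5, h6, norm_pow, norm_pow, Complex.norm_real, Complex.norm_real, Real.norm_eq_abs,
        Real.norm_eq_abs, sq_abs, sq_abs]
      have h8 : (ε ^ 2 * ‖w‖) ^ 2 ≤ (c ^ 2) ^ 2 := by gcongr
      linarith
    simpa using le_antisymm h4 (by positivity)
  refine LinearMap.det_eq_zero_iff_ker_ne_bot.2 fun hker => ?_
  have h0 : v = 0 := LinearMap.ker_eq_bot.1 hker (by rw [h1, map_zero])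
  simp [h0] at hv

theorem det_gramDefect_ne_zero {G : V →L[ℂ] V} {c ε : ℝ} (hε : 0 < ε)
    (h : ε * ‖G‖ < c) : LinearMap.det (gramDefect G c ε) ≠ 0 := by
  have hc : 0 ≤ c := le_trans (by positivity) h.le
  refine mt LinearMap.det_eq_zero_iff_ker_ne_bot.1 (not_not.2 ?_)
  refine LinearMap.ker_eq_bot'.2 fun v hv => ?_
  have h1 := inner_gramDefect G c ε v v
  rw [hv, inner_zero_right, inner_self_eq_norm_sq_to_K, inner_self_eq_norm_sq_to_K] at h1
  have h2 : (c * ‖v‖) ^ 2 = (ε * ‖G v‖) ^ 2 := by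
    have h3 : ((0 : ℝ) : ℂ) = ((c ^ 2 * ‖v‖ ^ 2 - ε ^ 2 * ‖G v‖ ^ 2 : ℝ) : ℂ) := by
      push_cast
      exact h1
    have := Complex.ofReal_injective h3
    linarith
  have h4 : c * ‖v‖ = ε * ‖G v‖ := (pow_left_inj₀ (by positivity) (by positivity) two_ne_zero).1 h2
  by_contra hne
  have hpos : 0 < ‖v‖ := norm_pos_iff.2 hne
  have h5 : ε * ‖G v‖ ≤ ε * ‖G‖ * ‖v‖ := by
    rw [mul_assoc]
    gcongr
    exact G.le_opNorm v
  have h6 : ε * ‖G‖ * ‖v‖ < c * ‖v‖ := by gcongr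
  linarith

/-- In an orthonormal basis the matrix entries of `c² - ε² G* G` are polynomials in the entries of
`G`, in `q`, and in their conjugates, with `c² = conj q * q`. -/
theorem isPolyReIm_det_gramDefect {𝒜 : Type*} [NormedRing 𝒜] [NormedAlgebra ℂ 𝒜] (a : 𝒜)
    (q : Polynomial ℂ) (Φ : 𝒜 →L[ℂ] V →L[ℂ] V) (ε : ℝ) :
    IsPolyReIm fun z =>
      LinearMap.det (gramDefect (Φ (resolventNumerator a q z)) ‖q.eval z‖ ε) := by
  set b := stdOrthonormalBasis ℂ V
  have hentry : ∀ i j, IsPolyReIm fun z => inner ℂ (b i) (Φ (resolventNumerator a q z) (b j)) :=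
    fun i j => IsPolyReIm.apply_resolventNumerator a q
      ((innerSL ℂ (b i)).toLinearMap ∘ₗ (ContinuousLinearMap.apply ℂ V (b j)).toLinearMap ∘ₗ
        Φ.toLinearMap)
  simp only [← LinearMap.det_toMatrix b.toBasis]
  refine IsPolyReIm.det fun i j => ?_
  have h1 : ∀ z, LinearMap.toMatrix b.toBasis b.toBasis
      (gramDefect (Φ (resolventNumerator a q z)) ‖q.eval z‖ ε) i j =
      starRingEnd ℂ (q.eval z) * q.eval z * inner ℂ (b i) (b j) - (ε : ℂ) ^ 2 *
        ∑ k, starRingEnd ℂ (inner ℂ (b k) (Φ (resolventNumerator a q z) (b i))) *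
          inner ℂ (b k) (Φ (resolventNumerator a q z) (b j)) := by
    intro z
    rw [LinearMap.toMatrix_apply, b.coe_toBasis_repr_apply, b.repr_apply_apply, b.coe_toBasis,
      inner_gramDefect, Complex.conj_mul']
    simp only [inner_conj_symm, b.sum_inner_mul_inner]
  simp only [h1]
  exact (((IsPolyReIm.eval q).conj.mul (.eval q)).mul (.const _)).sub ((IsPolyReIm.const _).mul
    (.sum _ fun k _ => (hentry k i).conj.mul (hentry k j)))

/-- Off the zeros of `q` the norm of `R` is continuous, so it equals `ε⁻¹` on the boundary. There
the numerator has norm `|q| / ε`, which puts the point on the algebraic curve. -/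
theorem boundaryLength_lt_top {𝒜 : Type*} [NormedRing 𝒜] [NormedAlgebra ℂ 𝒜] [CompleteSpace 𝒜]
    {a : 𝒜} {q : Polynomial ℂ} (hq : q ≠ 0) (hqa : Polynomial.aeval a q = 0)
    (Φ : 𝒜 →L[ℂ] V →L[ℂ] V) {ε : ℝ} (hε : 0 < ε) :
    boundaryLength (fun z => Φ (resolvent a z)) ε < ∞ := by
  set R : ℂ → V →L[ℂ] V := fun z => Φ (resolvent a z) with hR
  have hRq : ∀ z, q.eval z ≠ 0 → Φ (resolventNumerator a q z) = q.eval z • R z := fun z hz => by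
    rw [hR]
    simp only
    rw [resolvent_eq_resolventNumerator hqa hz, map_smul, smul_smul, mul_inv_cancel₀ hz, one_smul]
  have hfin : {z | q.eval z = 0}.Finite := by
    simpa [Polynomial.IsRoot] using Polynomial.finite_setOfPred_isRoot hq
  have hcont : ∀ z, q.eval z ≠ 0 → ContinuousAt R z := fun z hz => by
    have h1 : ContinuousAt (fun z => (q.eval z)⁻¹ • Φ (resolventNumerator a q z)) z :=
      (q.continuous.continuousAt.inv₀ hz).smul
        (Φ.continuous.continuousAt.comp (analyticAt_resolventNumerator a q z).continuousAt)
    refine h1.congr ?_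
    filter_upwards [q.continuous.continuousAt.eventually_ne hz] with w hw
    rw [hRq w hw, smul_smul, inv_mul_cancel₀ hw, one_smul]
  obtain ⟨p, hp⟩ := isPolyReIm_det_gramDefect a q Φ ε
  have hb := isBounded_pseudospectrum_resolvent a Φ hε
  have hp0 : p ≠ 0 := by
    rintro rfl
    -- Far out `‖R z‖ ≤ (2 * ε)⁻¹`; doubling `ε` gives the strict inequality `ε * ‖R z‖ < 1`, so the
    -- determinant is nonzero there and `p` cannot be zero.
    have h1 : ∀ᶠ z in Bornology.cobounded ℂ, z ∉ pseudospectrum R (2 * ε) :=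
      isBounded_pseudospectrum_resolvent a Φ (by positivity)
    have h2 : ∀ᶠ z in Bornology.cobounded ℂ, q.eval z ≠ 0 := hfin.isBounded
    obtain ⟨z, hz1, hz2⟩ := (h1.and h2).exists
    rw [mem_pseudospectrum_iff (hcont z hz2), not_lt, ← ofReal_norm,
      ENNReal.ofReal_le_ofReal_iff (by positivity)] at hz1
    have h3 := hp z
    rw [evalReIm, Polynomial.evalEval_zero] at h3
    refine det_gramDefect_ne_zero hε ?_ h3.symm
    rw [hRq z hz2, norm_smul]
    have hqz := norm_pos_iff.2 hz2
    have h4 : ε * ‖R z‖ < 1 := by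
      calc ε * ‖R z‖ ≤ ε * (2 * ε)⁻¹ := by gcongr
        _ = 1 / 2 := by field_simp
        _ < 1 := by norm_num
    nlinarith
  obtain ⟨r, hr⟩ := hb.closure.exists_norm_le
  have hsub : frontier (pseudospectrum R ε) ⊆
      {z | q.eval z = 0} ∪ {z | ‖z‖ ≤ r ∧ evalReIm p z = 0} := by
    intro z hz
    by_cases hqz : q.eval z = 0
    · exact .inl hqz
    refine .inr ⟨hr z (frontier_subset_closure hz), ?_⟩
    have hnorm : ‖R z‖ₑ = ENNReal.ofReal ε⁻¹ := by
      refine le_antisymm ?_ ?_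
      · by_contra! hlt
        have : z ∈ interior (pseudospectrum R ε) := by
          rw [mem_interior_iff_mem_nhds]
          filter_upwards [(hcont z hqz).enorm.eventually (lt_mem_nhds hlt),
            q.continuous.continuousAt.eventually_ne hqz] with w hw1 hw2
          rwa [mem_pseudospectrum_iff (hcont w hw2)]
        exact hz.2 this
      · by_contra! hlt
        have h1 : ∀ᶠ w in 𝓝 z, w ∉ pseudospectrum R ε := by
          filter_upwards [(hcont z hqz).enorm.eventually (gt_mem_nhds hlt),
            q.continuous.continuousAt.eventually_ne hqz] with w hw1 hw2
          rw [mem_pseudospectrum_iff (hcont w hw2)]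
          exact hw1.not_gt
        exact mem_closure_iff_frequently.1 hz.1 h1
    rw [← ofReal_norm, ENNReal.ofReal_eq_ofReal_iff (norm_nonneg _) (by positivity)] at hnorm
    rw [hp z]
    refine det_gramDefect_eq_zero (norm_pos_iff.2 hqz) hε ?_
    rw [hRq z hqz, norm_smul, hnorm, div_eq_mul_inv]
  refine (measure_mono hsub).trans_lt (measure_union_lt_top ?_ (hausdorffMeasure_zeros_lt_top hp0 r))
  have := Measure.nullSingletonClass_hausdorff ℂ (d := 1) zero_lt_one
  rw [hfin.measure_zero]
  exact ENNReal.zero_lt_top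

end InnerProduct

/-! ### The companion matrix and the recurrence. -/

section Companion

variable {V : Type*} [NormedAddCommGroup V] [NormedSpace ℂ V] {N : ℕ}

/-- The map that sends a block matrix to its block with the indices `0` and `j`. -/
noncomputable def blockMap (V : Type*) [NormedAddCommGroup V] [NormedSpace ℂ V] {N : ℕ}
    (j : Fin (N + 1)) :
    ((Fin (N + 1) → V) →L[ℂ] (Fin (N + 1) → V)) →L[ℂ] V →L[ℂ] V :=
  (ContinuousLinearMap.compL ℂ V (Fin (N + 1) → V) V (ContinuousLinearMap.proj 0)).comp
    ((ContinuousLinearMap.compL ℂ V (Fin (N + 1) → V) (Fin (N + 1) → V)).flip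
      (ContinuousLinearMap.single ℂ (fun _ : Fin (N + 1) => V) j))

theorem blockMap_apply (j : Fin (N + 1)) (T : (Fin (N + 1) → V) →L[ℂ] (Fin (N + 1) → V)) (v : V) :
    blockMap V j T v = T (Pi.single j v) 0 := rfl

theorem companion_apply {A : Fin (N + 1) → V →L[ℂ] V} {y : ℤ → V}
    (hy : ∀ n : ℕ, y ((n : ℤ) + 1) = ∑ j : Fin (N + 1), A j (y ((n : ℤ) - ((j : ℕ) : ℤ)))) (n : ℕ) :
    companion A (fun i => y ((n : ℤ) - ((i : ℕ) : ℤ))) =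
      fun i : Fin (N + 1) => y (((n + 1 : ℕ) : ℤ) - ((i : ℕ) : ℤ)) := by
  ext i
  refine Fin.cases ?_ (fun i' => ?_) i
  · simp [companion, hy]
  · simp [companion]

theorem companion_pow_apply {A : Fin (N + 1) → V →L[ℂ] V} {y : ℤ → V}
    (hy : ∀ n : ℕ, y ((n : ℤ) + 1) = ∑ j : Fin (N + 1), A j (y ((n : ℤ) - ((j : ℕ) : ℤ)))) (n : ℕ) :
    (companion A ^ n) (fun i => y (-((i : ℕ) : ℤ))) =
      fun i : Fin (N + 1) => y ((n : ℤ) - ((i : ℕ) : ℤ)) := by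
  induction n with
  | zero => simp
  | succ n ih => rw [pow_succ', mul_apply_eq_comp, ih, companion_apply hy]

theorem eq_sum_blockMap {A : Fin (N + 1) → V →L[ℂ] V} {y : ℤ → V}
    (hy : ∀ n : ℕ, y ((n : ℤ) + 1) = ∑ j : Fin (N + 1), A j (y ((n : ℤ) - ((j : ℕ) : ℤ)))) (n : ℕ) :
    y n = ∑ j : Fin (N + 1), blockMap V j (companion A ^ n) (y (-((j : ℕ) : ℤ))) := by
  have h1 := congrFun (companion_pow_apply hy n) 0
  rw [← Finset.univ_sum_single (fun i : Fin (N + 1) => y (-((i : ℕ) : ℤ))), map_sum,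
    Finset.sum_apply] at h1
  simpa [blockMap_apply] using h1.symm

theorem exists_aeval_companion_eq_zero [FiniteDimensional ℂ V] (A : Fin (N + 1) → V →L[ℂ] V) :
    ∃ q : Polynomial ℂ, q ≠ 0 ∧ Polynomial.aeval (companion A) q = 0 :=
  ⟨minpoly ℂ (companion A), minpoly.ne_zero (Algebra.IsIntegral.isIntegral _), minpoly.aeval _ _⟩

end Companion

end DiffEq

theorem mainTheorem4 {V : Type*} [NormedAddCommGroup V] [NormedSpace ℂ V] [FiniteDimensional ℂ V]
    (N : ℕ) (A : Fin (N + 1) → V →L[ℂ] V) (y : ℤ → V)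
    (hy : ∀ n : ℕ, y ((n : ℤ) + 1) = ∑ j : Fin (N + 1), A j (y ((n : ℤ) - ((j : ℕ) : ℤ))))
    (ε : ℝ) (hε : 0 < ε) :
    (∀ n : ℕ, ‖y (n : ℤ)‖ₑ ≤ DiffEq.growthBound A y ε n) ∧
    (∀ j : Fin (N + 1), DiffEq.pseudospectralRadius (DiffEq.genResolvent A j) ε < ∞) ∧
    ((∀ u v : V, ‖u + v‖ ^ 2 + ‖u - v‖ ^ 2 = 2 * (‖u‖ ^ 2 + ‖v‖ ^ 2)) →
      (∀ j : Fin (N + 1), DiffEq.boundaryLength (DiffEq.genResolvent A j) ε < ∞) ∧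
      ∀ n : ℕ, DiffEq.growthBound A y ε n < ∞) := by
  have hcomp : CompleteSpace V := FiniteDimensional.complete ℂ V
  obtain ⟨q, hq, hqa⟩ := DiffEq.exists_aeval_companion_eq_zero A
  have hρ : ∀ j : Fin (N + 1), DiffEq.pseudospectralRadius (DiffEq.genResolvent A j) ε < ∞ :=
    fun j => DiffEq.pseudospectralRadius_lt_top
      (DiffEq.isBounded_pseudospectrum_resolvent (DiffEq.companion A) (DiffEq.blockMap V j) hε)
  refine ⟨fun n => ?_, hρ, fun hpar => ?_⟩
  · rw [DiffEq.eq_sum_blockMap hy n]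
    refine (enorm_sum_le _ _).trans (Finset.sum_le_sum fun j _ => ?_)
    refine (ContinuousLinearMap.le_opENorm _ _).trans ?_
    gcongr
    exact DiffEq.enorm_apply_pow_le hq hqa (DiffEq.blockMap V j) hε n
  · have hL : ∀ j : Fin (N + 1), DiffEq.boundaryLength (DiffEq.genResolvent A j) ε < ∞ := by
      -- The parallelogram law yields an inner product inducing the given norm (Jordan–von Neumann).
      let _ : InnerProductSpace ℂ V := InnerProductSpace.ofNorm ℂ fun u v => by
        simpa only [sq] using hpar u v
      exact fun j => DiffEq.boundaryLength_lt_top hq hqa (DiffEq.blockMap V j) hε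
    refine ⟨hL, fun n => ?_⟩
    refine ENNReal.sum_lt_top.2 fun j _ => ENNReal.mul_lt_top (ENNReal.div_lt_top ?_ ?_)
      enorm_lt_top
    · exact (ENNReal.mul_lt_top (hL j) (ENNReal.pow_lt_top (hρ j))).ne
    · have : 0 < 2 * Real.pi * ε := by positivity
      simpa using this
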